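/- Let $m\ge 1$, $0<L\le\infty$, and let $w:[0,L)\to[0,\infty)$ be smooth with $w(0)=0$, $w'(0)=1$, $w^{(k)}(0)=0$ for all even $k$, and $w(r)>0$ for $r>0$. Let $M^m_w=[0,L)\times_w S^{m-1}_1$ be the model space with metric $dr^2+w(r)^2\,d\theta^2$, where $r=0$ is collapsed to one point, the pole $p$ (also written $0$), and let $B=B^w_R$ be the geodesic ball of radius $R$ centred at $p$, where $0<R<L$. Then $B$ has a smallest Dirichlet eigenvalue $\lambda_1(B)$, that is, a smallest real $\lambda$ for which there is $u\in C^2(B)\cap C^0(\overline B)$, $u\not\equiv0$, with $\Delta u+\lambda u=0$ on $B$ and $u=0$ on $\partial B$ (such a $u$ is called a Dirichlet eigenfunction for $\lambda$). There are functions $u_k$, $k\ge0$, with $u_0=1$ on $B$ and, for $k\ge1$, $u_k\in C^2(B)\cap C^0(\overline B)$, $$\Delta u_k+k\,u_{k-1}=0\ \text{ on } B,\qquad u_k=0\ \text{ on }\partial B .$$ For any such functions $u_k$ put $\mathcal A_k(B)=\int_B u_k\,dV$. Then $u_k(p)>0$ and $\mathcal A_k(B)>0$ for all $k\ge 0$,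 and $$\lambda_1(B)=\lim_{k\to\infty}\frac{k\,u_{k-1}(p)}{u_k(p)}=\lim_{k\to\infty}\frac{k\,\mathcal A_{k-1}(B)}{\mathcal A_k(B)} .$$ Moreover, the limit $\lim_{k\to\infty}u_k(x)/u_k(p)$ exists for every $x\in\overline B$; it depends only on the distance $r(x)$ of $x$ to $p$, so it equals $g_\infty(r(x))$ for a function $g_\infty$ on $[0,R]$; this $g_\infty$ is of class $C^2$ on $[0,R]$, and $x\mapsto g_\infty(r(x))$ is a Dirichlet eigenfunction of $B$ for $\lambda_1(B)$. -/

import Mathlib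

open scoped ContDiff

noncomputable section

namespace ModelSpace

/-! ### Riemannian geometry in one global chart

A Riemannian metric on an open subset of `ℝᵐ` is given by its Gram matrices `g x = (g_{ij}(x))`. -/

/-- The partial derivative `∂ᵢ f (x)`. -/
def partialDeriv {m : ℕ} (i : Fin m) (f : EuclideanSpace ℝ (Fin m) → ℝ)
    (x : EuclideanSpace ℝ (Fin m)) : ℝ :=
  fderiv ℝ f x (EuclideanSpace.single i 1)

/-- The density `√(det g)` of the Riemannian volume with respect to Lebesgue measure. -/
def volumeDensity {m : ℕ} (g : EuclideanSpace ℝ (Fin m) → Matrix (Fin m) (Fin m) ℝ)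
    (x : EuclideanSpace ℝ (Fin m)) : ℝ :=
  Real.sqrt (g x).det

/-- The Laplace-Beltrami operator
`Δ u = (det g)^{-1/2} ∑ᵢ ∂ᵢ ((det g)^{1/2} ∑ⱼ g^{ij} ∂ⱼ u)`. -/
def laplaceBeltrami {m : ℕ} (g : EuclideanSpace ℝ (Fin m) → Matrix (Fin m) (Fin m) ℝ)
    (u : EuclideanSpace ℝ (Fin m) → ℝ) (x : EuclideanSpace ℝ (Fin m)) : ℝ :=
  (volumeDensity g x)⁻¹ *
    ∑ i, partialDeriv i
      (fun y => volumeDensity g y * ∑ j, (g y)⁻¹ i j * partialDeriv j u y) x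

/-- The `g`-length of a `C¹` curve `γ : [0,1] → ℝᵐ`. -/
def curveLength {m : ℕ} (g : EuclideanSpace ℝ (Fin m) → Matrix (Fin m) (Fin m) ℝ)
    (γ : ℝ → EuclideanSpace ℝ (Fin m)) : ENNReal :=
  ∫⁻ t in Set.Icc (0 : ℝ) 1, ENNReal.ofReal (Real.sqrt
    (∑ i, ∑ j, g (γ t) i j * deriv γ t i * deriv γ t j))

/-- The Riemannian distance on the open set `U` with metric `g`: the infimum of the lengths of
the `C¹` curves in `U` from `x` to `y`. -/
def riemDist {m : ℕ} (g : EuclideanSpace ℝ (Fin m) → Matrix (Fin m) (Fin m) ℝ)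
    (U : Set (EuclideanSpace ℝ (Fin m))) (x y : EuclideanSpace ℝ (Fin m)) : ENNReal :=
  ⨅ (γ : ℝ → EuclideanSpace ℝ (Fin m)) (_ : ContDiff ℝ 1 γ) (_ : γ 0 = x) (_ : γ 1 = y)
    (_ : ∀ t ∈ Set.Icc (0 : ℝ) 1, γ t ∈ U), curveLength g γ

/-- `u ∈ C²(D) ∩ C⁰(closure D)` is a (classical) Dirichlet eigenfunction of the domain `D` with
eigenvalue `lam`: it does not vanish identically, `Δ u + lam u = 0` on `D` and `u = 0` on `∂D`. -/
structure IsDirichletEigenfunction {m : ℕ}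
    (g : EuclideanSpace ℝ (Fin m) → Matrix (Fin m) (Fin m) ℝ)
    (D : Set (EuclideanSpace ℝ (Fin m))) (lam : ℝ)
    (u : EuclideanSpace ℝ (Fin m) → ℝ) : Prop where
  contDiffOn : ContDiffOn ℝ 2 u D
  continuousOn : ContinuousOn u (closure D)
  ne_zero : ∃ x ∈ D, u x ≠ 0
  equation : ∀ x ∈ D, laplaceBeltrami g u x + lam * u x = 0
  boundary : ∀ x ∈ frontier D, u x = 0

/-- The set of Dirichlet eigenvalues of `D`. -/
def dirichletEigenvalues {m : ℕ} (g : EuclideanSpace ℝ (Fin m) → Matrix (Fin m) (Fin m) ℝ)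
    (D : Set (EuclideanSpace ℝ (Fin m))) : Set ℝ :=
  {lam | ∃ u, IsDirichletEigenfunction g D lam u}

/-- The first Dirichlet eigenvalue `λ₁(D)`. -/
def lambda1 {m : ℕ} (g : EuclideanSpace ℝ (Fin m) → Matrix (Fin m) (Fin m) ℝ)
    (D : Set (EuclideanSpace ℝ (Fin m))) : ℝ :=
  sInf (dirichletEigenvalues g D)

/-- `u 0, u 1, u 2, …` are the exit time moment functions of `D`: `u 0 = 1` on `D` and, for
`k ≥ 1`, `u k` is the classical solution of `Δ (u k) + k u (k-1) = 0` on `D`, `u k = 0` on `∂D`. -/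
structure IsExitMomentSequence {m : ℕ}
    (g : EuclideanSpace ℝ (Fin m) → Matrix (Fin m) (Fin m) ℝ)
    (D : Set (EuclideanSpace ℝ (Fin m))) (u : ℕ → EuclideanSpace ℝ (Fin m) → ℝ) : Prop where
  zero_eq_one : ∀ x ∈ D, u 0 x = 1
  contDiffOn : ∀ k, ContDiffOn ℝ 2 (u (k + 1)) D
  continuousOn : ∀ k, ContinuousOn (u (k + 1)) (closure D)
  equation : ∀ k, ∀ x ∈ D, laplaceBeltrami g (u (k + 1)) x + ((k : ℝ) + 1) * u k x = 0
  boundary : ∀ k, ∀ x ∈ frontier D, u (k + 1) x = 0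

/-- The integral `∫_D f dV` against the Riemannian volume; for `f = u k` this is the `L¹`-moment
`𝒜_k(D)`. -/
def volumeIntegral {m : ℕ} (g : EuclideanSpace ℝ (Fin m) → Matrix (Fin m) (Fin m) ℝ)
    (D : Set (EuclideanSpace ℝ (Fin m))) (f : EuclideanSpace ℝ (Fin m) → ℝ) : ℝ :=
  ∫ x in D, f x * volumeDensity g x

/-! ### Rotationally symmetric model spaces -/

/-- The interval `[0, L)`, where `0 < L ≤ ∞`. -/
def baseInterval (L : EReal) : Set ℝ := {r | 0 ≤ r ∧ (r : EReal) < L}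

/-- `w : [0, L) → [0, ∞)` is the warping function of a model space. -/
structure IsWarpingFunction (L : EReal) (w : ℝ → ℝ) : Prop where
  smooth : ContDiffOn ℝ ∞ w (baseInterval L)
  zero : w 0 = 0
  deriv_zero : derivWithin w (baseInterval L) 0 = 1
  even_deriv_zero : ∀ k : ℕ, Even k → iteratedDerivWithin k w (baseInterval L) 0 = 0
  pos : ∀ r ∈ baseInterval L, 0 < r → 0 < w r

/-- The underlying set of the model space `M^m_w = [0, L) ×_w S^{m-1}`: the sphere `{0} × S^{m-1}`
is collapsed to the centre point, and `(r, θ)` is written as `x = r θ ∈ ℝᵐ`, `r < L`. -/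
def modelDomain (m : ℕ) (L : EReal) : Set (EuclideanSpace ℝ (Fin m)) :=
  {x | ((‖x‖ : ℝ) : EReal) < L}

/-- The warped product metric `dr² + w(r)² dθ²` in the coordinates `x = r θ`. Since
`dr² + r² dθ²` is the Euclidean metric and `dr = ∑ᵢ (xᵢ / r) dxᵢ`, it equals
`(x xᵀ) / r² + (w(r) / r)² (1 - (x xᵀ) / r²)` off the centre point; at the centre point it is the
identity. -/
def modelMetric (m : ℕ) (w : ℝ → ℝ) (x : EuclideanSpace ℝ (Fin m)) :
    Matrix (Fin m) (Fin m) ℝ :=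
  if x = 0 then 1
  else Matrix.of fun i j =>
    x i * x j / ‖x‖ ^ 2 +
      (w ‖x‖ / ‖x‖) ^ 2 * ((1 : Matrix (Fin m) (Fin m) ℝ) i j - x i * x j / ‖x‖ ^ 2)

/-- The distance `r(x)` to the centre point of the model space. -/
def poleDist (m : ℕ) (L : EReal) (w : ℝ → ℝ) (x : EuclideanSpace ℝ (Fin m)) : ENNReal :=
  riemDist (modelMetric m w) (modelDomain m L) 0 x

/-- The geodesic ball `B^w_R` of radius `R` centred at the centre point of the model space. -/
def modelBall (m : ℕ) (L : EReal) (w : ℝ → ℝ) (R : ℝ) : Set (EuclideanSpace ℝ (Fin m)) :=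
  {x | x ∈ modelDomain m L ∧ poleDist m L w x < ENNReal.ofReal R}

end ModelSpace

end

noncomputable section

namespace ModelSpace

open Filter Topology Set MeasureTheory

/-! ### The model metric and the distance to the pole -/

/-! The problem is radial, and a positive integral operator replaces spectral theory. Put `n = m -
1`. A radial function with profile `a` has Laplacian `w⁻ⁿ (wⁿ a')'`, so on the ball the radial
Dirichlet problem `Δu = -b` is solved by `T b (r) = ∫_r^R w⁻ⁿ ∫_0^s wⁿ b`, which is `radialGreen`.
The weak maximum principle gives uniqueness (`eq_radialGreen`), hence `u_k = k! a_k` with `a_k = Tᵏ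
1` (`greenIter`). Everything is thereby reduced to the iterates of `T` on one interval.

The decisive fact is that `T` preserves the relation "`f / g` is decreasing"
(`crossAntitone_radialGreen`). Since `T1 / 1` is decreasing, so is `a_{k+1} / a_k` for every `k`.
Its maximum is therefore the value `ρ_k` at the pole (`greenRatio`), so that `a_{k+1} ≤ ρ_k a_k`.
Applying `T` shows that `ρ_k` decreases in `k`, and the functions `g_k = a_k / a_k(0)` decrease in
`k` pointwise. The `ρ_k` stay above a positive constant (`exists_le_greenRatio`), hence `ρ_k → μ >
0` and `g_k → G`. The limit in `T g_k = ρ_k g_{k+1}` is `T G = μ G`, and `G(r(x))` is an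
eigenfunction for `1/μ`.

No eigenvalue is smaller. An eigenfunction `v` for `lam` with `|v| ≤ C` satisfies `|v| ≤ C |lam|ᵏ
a_k` by repeated comparison (`eigenfunction_le`). For `0 < lam < 1/μ` the ratio test sends the right
side to `0`; `lam = 0` already fails at `k = 1`, and `lam < 0` contradicts the maximum principle.

The pole quotients are `1 / ρ_k`. The moments are `k! a_k(0) ∫ g_k dV` with `∫ g_k dV → ∫ G dV > 0`,
so their quotients have the same limit.

The remaining work is regularity at the pole in the Cartesian chart, where `‖x‖` is not smooth. It
rests on `w(r)/r = 1 + o(r)`, a consequence of `w(0) = w''(0) = 0` and `w'(0) = 1`. -/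

theorem real_inner_eq_sum {m : ℕ} (x y : EuclideanSpace ℝ (Fin m)) :
    inner ℝ x y = ∑ i, x i * y i := by
  rw [PiLp.inner_apply]
  exact Finset.sum_congr rfl fun i _ => by simp [mul_comm]

theorem modelMetric_zero (m : ℕ) (w : ℝ → ℝ) : modelMetric m w 0 = 1 := by
  simp [modelMetric]

theorem modelMetric_apply_of_ne {m : ℕ} (w : ℝ → ℝ) {x : EuclideanSpace ℝ (Fin m)} (hx : x ≠ 0)
    (i j : Fin m) :
    modelMetric m w x i j = x i * x j / ‖x‖ ^ 2 +
      (w ‖x‖ / ‖x‖) ^ 2 * ((1 : Matrix (Fin m) (Fin m) ℝ) i j - x i * x j / ‖x‖ ^ 2) := by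
  simp [modelMetric, hx]

theorem one_quadForm {m : ℕ} (v : EuclideanSpace ℝ (Fin m)) :
    ∑ i, ∑ j, (1 : Matrix (Fin m) (Fin m) ℝ) i j * v i * v j = ‖v‖ ^ 2 := by
  rw [EuclideanSpace.real_norm_sq_eq]
  refine Finset.sum_congr rfl fun i _ => ?_
  simp [Matrix.one_apply, sq]

theorem sum_mul_quadForm {m : ℕ} (x v : EuclideanSpace ℝ (Fin m)) :
    ∑ i, ∑ j, x i * x j * v i * v j = inner ℝ x v ^ 2 := by
  rw [real_inner_eq_sum, sq, Finset.sum_mul_sum]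
  exact Finset.sum_congr rfl fun i _ => Finset.sum_congr rfl fun j _ => by ring

theorem modelMetric_quadForm {m : ℕ} (w : ℝ → ℝ) {x : EuclideanSpace ℝ (Fin m)} (hx : x ≠ 0)
    (v : EuclideanSpace ℝ (Fin m)) :
    ∑ i, ∑ j, modelMetric m w x i j * v i * v j =
      (inner ℝ x v / ‖x‖) ^ 2 + (w ‖x‖ / ‖x‖) ^ 2 * (‖v‖ ^ 2 - (inner ℝ x v / ‖x‖) ^ 2) := by
  have h : ∀ i j, modelMetric m w x i j * v i * v j =
      (1 - (w ‖x‖ / ‖x‖) ^ 2) / ‖x‖ ^ 2 * (x i * x j * v i * v j) +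
      (w ‖x‖ / ‖x‖) ^ 2 * ((1 : Matrix (Fin m) (Fin m) ℝ) i j * v i * v j) := by
    intro i j
    rw [modelMetric_apply_of_ne w hx]
    ring
  simp only [h, Finset.sum_add_distrib, ← Finset.mul_sum, one_quadForm, sum_mul_quadForm]
  ring

theorem inner_div_norm_sq_le {m : ℕ} {x : EuclideanSpace ℝ (Fin m)} (hx : x ≠ 0)
    (v : EuclideanSpace ℝ (Fin m)) : (inner ℝ x v / ‖x‖) ^ 2 ≤ ‖v‖ ^ 2 := by
  have hn : 0 < ‖x‖ := norm_pos_iff.2 hx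
  rw [div_pow, div_le_iff₀ (by positivity), ← mul_pow, ← sq_abs (inner ℝ x v)]
  refine pow_le_pow_left₀ (abs_nonneg _) ?_ 2
  rw [mul_comm]
  exact abs_real_inner_le_norm x v

/-- The angular part of the quadratic form is nonnegative; dropping it leaves the square of the
radial component. -/
theorem abs_inner_div_norm_le_sqrt_quadForm {m : ℕ} (w : ℝ → ℝ) {x : EuclideanSpace ℝ (Fin m)}
    (hx : x ≠ 0) (v : EuclideanSpace ℝ (Fin m)) :
    |inner ℝ x v / ‖x‖| ≤ Real.sqrt (∑ i, ∑ j, modelMetric m w x i j * v i * v j) := by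
  rw [modelMetric_quadForm w hx]
  refine Real.abs_le_sqrt ?_
  have := inner_div_norm_sq_le hx v
  nlinarith [mul_nonneg (sq_nonneg (w ‖x‖ / ‖x‖)) (sub_nonneg.2 this)]

theorem hasDerivAt_norm_comp {m : ℕ} {γ : ℝ → EuclideanSpace ℝ (Fin m)} {t : ℝ}
    {v : EuclideanSpace ℝ (Fin m)} (hγ : HasDerivAt γ v t) (h0 : γ t ≠ 0) :
    HasDerivAt (fun s => ‖γ s‖) (inner ℝ (γ t) v / ‖γ t‖) t := by
  have h := (hγ.norm_sq).sqrt (by positivity)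
  simp only [Real.sqrt_sq (norm_nonneg _)] at h
  convert h using 1
  have : ‖γ t‖ ≠ 0 := norm_ne_zero_iff.2 h0
  field_simp

/-- Along the curve `‖γ‖` grows no faster than the arc length. The norm is not differentiable at the
pole, so the fundamental theorem of calculus is used only after the last visit there. -/
theorem norm_le_curveLength {m : ℕ} (w : ℝ → ℝ) {γ : ℝ → EuclideanSpace ℝ (Fin m)}
    (hγ : ContDiff ℝ 1 γ) (h0 : γ 0 = 0) :
    ENNReal.ofReal ‖γ 1‖ ≤ curveLength (modelMetric m w) γ := by
  by_cases hx : γ 1 = 0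
  · simp [hx]
  -- The times at which the curve sits at the pole; their supremum `a` is the last one.
  set S : Set ℝ := Icc 0 1 ∩ γ ⁻¹' {0} with hS
  have hScomp : IsCompact S :=
    isCompact_Icc.inter_right (isClosed_singleton.preimage hγ.continuous)
  have hSne : S.Nonempty := ⟨0, ⟨by simp, h0⟩⟩
  set a := sSup S with ha
  have haS : a ∈ S := hScomp.sSup_mem hSne
  have ha0 : γ a = 0 := haS.2
  have ha1 : a < 1 := lt_of_le_of_ne haS.1.2 fun h => hx (by rw [← h]; exact ha0)
  have hne : ∀ t ∈ Ioc a 1, γ t ≠ 0 := by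
    intro t ht hz
    have : t ∈ S := ⟨⟨haS.1.1.trans ht.1.le, ht.2⟩, hz⟩
    exact absurd (le_csSup hScomp.bddAbove this) (not_le.2 ht.1)
  have hder : ∀ t, HasDerivAt γ (deriv γ t) t := fun t =>
    (hγ.differentiable one_ne_zero t).hasDerivAt
  have hcd : Continuous (deriv γ) := hγ.continuous_deriv le_rfl
  set f' : ℝ → ℝ := fun t => inner ℝ (γ t) (deriv γ t) / ‖γ t‖ with hf'
  have hmeas : Measurable f' :=
    ((hγ.continuous.inner hcd).measurable).div hγ.continuous.norm.measurable
  -- The integrand need not be continuous at `a`, but it is bounded by `‖γ'‖` everywhere.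
  have hint : IntervalIntegrable f' volume a 1 := by
    refine (hcd.norm.intervalIntegrable a 1).mono_fun hmeas.aestronglyMeasurable ?_
    refine Eventually.of_forall fun t => ?_
    simp only [hf', norm_div, norm_norm]
    exact div_le_of_le_mul₀ (norm_nonneg _) (norm_nonneg _)
      ((norm_inner_le_norm _ _).trans_eq (mul_comm _ _))
  have hftc := intervalIntegral.integral_eq_sub_of_hasDerivAt_of_le (f := fun t => ‖γ t‖)
    (f' := f') ha1.le hγ.continuous.norm.continuousOn
    (fun t ht => hasDerivAt_norm_comp (hder t) (hne t ⟨ht.1, ht.2.le⟩)) hint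
  rw [ha0, norm_zero, sub_zero, intervalIntegral.integral_of_le ha1.le] at hftc
  calc ENNReal.ofReal ‖γ 1‖ = ‖∫ t in Ioc a 1, f' t‖ₑ := by
        rw [hftc, Real.enorm_eq_ofReal (norm_nonneg _)]
    _ ≤ ∫⁻ t in Ioc a 1, ‖f' t‖ₑ := enorm_integral_le_lintegral_enorm _
    _ ≤ ∫⁻ t in Ioc a 1, ENNReal.ofReal (Real.sqrt
          (∑ i, ∑ j, modelMetric m w (γ t) i j * deriv γ t i * deriv γ t j)) := by
        refine setLIntegral_mono' measurableSet_Ioc fun t ht => ?_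
        rw [Real.enorm_eq_ofReal_abs]
        exact ENNReal.ofReal_le_ofReal (abs_inner_div_norm_le_sqrt_quadForm w (hne t ht) _)
    _ ≤ curveLength (modelMetric m w) γ :=
        lintegral_mono_set (fun t ht => ⟨haS.1.1.trans ht.1.le, ht.2⟩)

theorem curveLength_ray {m : ℕ} (w : ℝ → ℝ) (x : EuclideanSpace ℝ (Fin m)) :
    curveLength (modelMetric m w) (fun t => t • x) = ENNReal.ofReal ‖x‖ := by
  have hd : ∀ t : ℝ, deriv (fun t : ℝ => t • x) t = x := fun t => by
    simpa using ((hasDerivAt_id t).smul_const x).deriv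
  have hq : ∀ t : ℝ, Real.sqrt (∑ i, ∑ j, modelMetric m w (t • x) i j * x i * x j) = ‖x‖ := by
    intro t
    by_cases h : t • x = 0
    · rw [h, modelMetric_zero, one_quadForm, Real.sqrt_sq (norm_nonneg _)]
    · rw [modelMetric_quadForm w h]
      have ht : t ≠ 0 := fun h' => h (by simp [h'])
      have hx : ‖x‖ ≠ 0 := norm_ne_zero_iff.2 fun h' => h (by simp [h'])
      have : (inner ℝ (t • x) x / ‖t • x‖) ^ 2 = ‖x‖ ^ 2 := by
        rw [real_inner_smul_left, real_inner_self_eq_norm_sq, norm_smul, div_pow, mul_pow, mul_pow,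
          Real.norm_eq_abs, sq_abs]
        field_simp
      rw [this, sub_self, mul_zero, add_zero, Real.sqrt_sq (norm_nonneg _)]
  simp [curveLength, hd, hq]

theorem poleDist_eq {m : ℕ} {L : EReal} (w : ℝ → ℝ) {x : EuclideanSpace ℝ (Fin m)}
    (hx : x ∈ modelDomain m L) : poleDist m L w x = ENNReal.ofReal ‖x‖ := by
  apply le_antisymm
  · rw [← curveLength_ray w x]
    refine iInf_le_of_le (fun t => t • x) (iInf_le_of_le (by fun_prop) (iInf_le_of_le (by simp)
      (iInf_le_of_le (by simp) (iInf_le_of_le ?_ le_rfl))))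
    intro t ht
    refine lt_of_le_of_lt (EReal.coe_le_coe_iff.2 ?_) hx
    rw [norm_smul, Real.norm_of_nonneg ht.1]
    exact mul_le_of_le_one_left (norm_nonneg _) ht.2
  · refine le_iInf fun γ => le_iInf fun hγ => le_iInf fun h0 => le_iInf fun h1 => le_iInf fun _ => ?_
    rw [← h1]
    exact norm_le_curveLength w hγ h0

theorem toReal_poleDist_eq {m : ℕ} {L : EReal} (w : ℝ → ℝ) {x : EuclideanSpace ℝ (Fin m)}
    (hx : x ∈ modelDomain m L) : (poleDist m L w x).toReal = ‖x‖ := by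
  rw [poleDist_eq w hx, ENNReal.toReal_ofReal (norm_nonneg _)]

/-- The distance to the pole is the Euclidean norm, so all later analysis takes place on a Euclidean
ball. -/
theorem modelBall_eq_ball {m : ℕ} {L : EReal} (w : ℝ → ℝ) {R : ℝ} (hRL : (R : EReal) < L) :
    modelBall m L w R = Metric.ball 0 R := by
  ext x
  simp only [modelBall, mem_ofPred_eq, mem_ball_zero_iff]
  constructor
  · rintro ⟨hx, h⟩
    rw [poleDist_eq w hx] at h
    exact (ENNReal.ofReal_lt_ofReal_iff'.1 h).1
  · intro h
    have hx : x ∈ modelDomain m L := (EReal.coe_lt_coe_iff.2 h).trans hRL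
    refine ⟨hx, ?_⟩
    rw [poleDist_eq w hx]
    exact ENNReal.ofReal_lt_ofReal_iff'.2 ⟨h, (norm_nonneg _).trans_lt h⟩

/-! ### Algebra of the model metric -/

/-- The ratio `w r / r`, continued by `1` to the pole. -/
def warpRatio (w : ℝ → ℝ) (r : ℝ) : ℝ := if r = 0 then 1 else w r / r

theorem warpRatio_zero (w : ℝ → ℝ) : warpRatio w 0 = 1 := by simp [warpRatio]

theorem warpRatio_of_ne (w : ℝ → ℝ) {r : ℝ} (hr : r ≠ 0) : warpRatio w r = w r / r := by
  simp [warpRatio, hr]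

/-- The orthogonal projection to the radial direction. -/
def radialProj {m : ℕ} (x : EuclideanSpace ℝ (Fin m)) : Matrix (Fin m) (Fin m) ℝ :=
  (‖x‖ ^ 2)⁻¹ • Matrix.vecMulVec x.ofLp x.ofLp

theorem radialProj_apply {m : ℕ} (x : EuclideanSpace ℝ (Fin m)) (i j : Fin m) :
    radialProj x i j = x i * x j / ‖x‖ ^ 2 := by
  simp [radialProj, Matrix.vecMulVec_apply]
  ring

theorem radialProj_zero (m : ℕ) : radialProj (0 : EuclideanSpace ℝ (Fin m)) = 0 := by
  simp [radialProj]

theorem dotProduct_self_eq_norm_sq {m : ℕ} (x : EuclideanSpace ℝ (Fin m)) :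
    x.ofLp ⬝ᵥ x.ofLp = ‖x‖ ^ 2 := by
  rw [EuclideanSpace.real_norm_sq_eq]
  simp [dotProduct, sq]

theorem radialProj_mul_self {m : ℕ} (x : EuclideanSpace ℝ (Fin m)) :
    radialProj x * radialProj x = radialProj x := by
  by_cases hx : x = 0
  · simp [hx, radialProj_zero]
  have : ‖x‖ ≠ 0 := norm_ne_zero_iff.2 hx
  rw [radialProj, Matrix.smul_mul, Matrix.mul_smul, Matrix.vecMulVec_mul_vecMulVec,
    dotProduct_self_eq_norm_sq, Matrix.vecMulVec_smul, smul_smul (_⁻¹) (‖x‖ ^ 2)]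
  congr 1
  rw [inv_mul_cancel₀ (by positivity), one_smul]

theorem abs_radialProj_apply_le {m : ℕ} (x : EuclideanSpace ℝ (Fin m)) (i j : Fin m) :
    |radialProj x i j| ≤ 1 := by
  rw [radialProj_apply, abs_div, abs_mul, abs_of_nonneg (sq_nonneg ‖x‖), sq]
  exact div_le_one_of_le₀ (mul_le_mul (PiLp.norm_apply_le x i) (PiLp.norm_apply_le x j)
    (abs_nonneg _) (norm_nonneg _)) (by positivity)

/-- With `P` the radial projection and `h = w / r`, the metric is `P + h² (1 - P)` off the pole. The
arrangement below is also right at the pole, where `P` takes the default value `0` and `h = 1`. -/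
theorem modelMetric_eq {m : ℕ} (w : ℝ → ℝ) (x : EuclideanSpace ℝ (Fin m)) :
    modelMetric m w x = (warpRatio w ‖x‖ ^ 2) • (1 : Matrix (Fin m) (Fin m) ℝ) +
      (1 - warpRatio w ‖x‖ ^ 2) • radialProj x := by
  by_cases hx : x = 0
  · simp [hx, modelMetric_zero, warpRatio_zero]
  · ext i j
    rw [modelMetric_apply_of_ne w hx, warpRatio_of_ne w (norm_ne_zero_iff.2 hx)]
    simp only [Matrix.add_apply, Matrix.smul_apply, radialProj_apply, smul_eq_mul]
    ring

theorem modelMetric_inv {m : ℕ} (w : ℝ → ℝ) {x : EuclideanSpace ℝ (Fin m)}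
    (hx : warpRatio w ‖x‖ ≠ 0) :
    (modelMetric m w x)⁻¹ = ((warpRatio w ‖x‖ ^ 2)⁻¹) • (1 : Matrix (Fin m) (Fin m) ℝ) +
      (1 - (warpRatio w ‖x‖ ^ 2)⁻¹) • radialProj x := by
  apply Matrix.inv_eq_right_inv
  rw [modelMetric_eq]
  set c := warpRatio w ‖x‖ ^ 2
  have hc : c ≠ 0 := pow_ne_zero 2 hx
  simp only [add_mul, mul_add, Matrix.smul_mul, Matrix.mul_smul, one_mul, mul_one,
    radialProj_mul_self, smul_smul]
  rw [inv_mul_cancel₀ hc, one_smul, add_assoc, ← add_smul, ← add_smul]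
  have h0 : c⁻¹ * (1 - c) + ((1 - c⁻¹) * c + (1 - c⁻¹) * (1 - c)) = 0 := by
    field_simp
    ring
  rw [h0, zero_smul, add_zero]

/-- The metric is `h²` times a rank-one perturbation of the identity, so the matrix determinant
lemma applies: the eigenvalues are `1` once and `h²` with multiplicity `m - 1`. -/
theorem modelMetric_det {m : ℕ} (hm : 1 ≤ m) (w : ℝ → ℝ) {x : EuclideanSpace ℝ (Fin m)}
    (hx : warpRatio w ‖x‖ ≠ 0) : (modelMetric m w x).det = (warpRatio w ‖x‖ ^ (m - 1)) ^ 2 := by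
  by_cases h0 : x = 0
  · simp [h0, modelMetric_zero, warpRatio_zero]
  have hn : ‖x‖ ≠ 0 := norm_ne_zero_iff.2 h0
  set h := warpRatio w ‖x‖ with hh
  have : modelMetric m w x = (h ^ 2) • (1 + Matrix.replicateCol Unit
      (((h ^ 2)⁻¹ - 1) • (‖x‖ ^ 2)⁻¹ • x.ofLp) * Matrix.replicateRow Unit x.ofLp) := by
    rw [modelMetric_eq, smul_add]
    congr 1
    ext i j
    simp only [Matrix.smul_apply, radialProj_apply, smul_eq_mul, Matrix.mul_apply, Pi.smul_apply,
      Matrix.replicateCol_apply, Matrix.replicateRow_apply, Finset.univ_unique, Finset.sum_singleton]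
    rw [← hh]
    field_simp
  rw [this, Matrix.det_smul, Matrix.det_one_add_replicateCol_mul_replicateRow, dotProduct_smul,
    dotProduct_smul, dotProduct_self_eq_norm_sq, Fintype.card_fin]
  obtain ⟨n, rfl⟩ : ∃ n, m = n + 1 := ⟨m - 1, by omega⟩
  simp only [smul_eq_mul, Nat.add_sub_cancel]
  rw [inv_mul_cancel₀ (by positivity), mul_one, add_sub_cancel, ← pow_mul, ← pow_mul]
  field_simp
  ring

theorem volumeDensity_modelMetric {m : ℕ} (hm : 1 ≤ m) (w : ℝ → ℝ)
    {x : EuclideanSpace ℝ (Fin m)} (hx : 0 < warpRatio w ‖x‖) :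
    volumeDensity (modelMetric m w) x = warpRatio w ‖x‖ ^ (m - 1) := by
  rw [volumeDensity, modelMetric_det hm w hx.ne', Real.sqrt_sq (by positivity)]

/-! ### Regularity of the warping function -/

/-- The regularity of a warping function `w` on `[0, S)` on which the analysis of radial functions
rests. -/
structure IsRegularWarp (w : ℝ → ℝ) (S : ℝ) : Prop where
  S_pos : 0 < S
  zero : w 0 = 0
  pos : ∀ r ∈ Ioo 0 S, 0 < w r
  hasDerivAt : ∀ r ∈ Ioo 0 S, HasDerivAt w (deriv w r) r
  continuousOn_deriv : ContinuousOn (deriv w) (Ioo 0 S)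
  tendsto_deriv : Tendsto (deriv w) (𝓝[>] 0) (𝓝 1)
  tendsto_warpRatio : Tendsto (fun r => (w r / r - 1) / r) (𝓝[>] 0) (𝓝 0)

/-- Because `S < L`, one-sided derivatives within `[0, L)` are ordinary ones on `(0, S)`. Since
`w''(0) = 0`, l'Hôpital's rule gives `w(r) - r = o(r²)`. -/
theorem IsWarpingFunction.isRegularWarp {L : EReal} {w : ℝ → ℝ} (hw : IsWarpingFunction L w)
    {S : ℝ} (hS : 0 < S) (hSL : (S : EReal) < L) : IsRegularWarp w S := by
  set I := baseInterval L with hI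
  have hsub : Icc 0 S ⊆ I := fun r hr => ⟨hr.1, (EReal.coe_le_coe_iff.2 hr.2).trans_lt hSL⟩
  have h0I : (0 : ℝ) ∈ I := hsub ⟨le_rfl, hS.le⟩
  have hconv : Convex ℝ I := by
    refine Set.OrdConnected.convex ⟨fun x hx y hy z hz => ⟨hx.1.trans hz.1, ?_⟩⟩
    exact (EReal.coe_le_coe_iff.2 hz.2).trans_lt hy.2
  have hint : (interior I).Nonempty := by
    refine ⟨S / 2, mem_interior.2 ⟨Ioo 0 S, Ioo_subset_Icc_self.trans hsub, isOpen_Ioo, ?_⟩⟩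
    exact ⟨by linarith, by linarith⟩
  have hu : UniqueDiffOn ℝ I := uniqueDiffOn_convex hconv hint
  have hnhds : ∀ r ∈ Ioo 0 S, I ∈ 𝓝 r := fun r hr =>
    mem_of_superset (isOpen_Ioo.mem_nhds hr) (Ioo_subset_Icc_self.trans hsub)
  have hder : ∀ r ∈ Ioo 0 S, derivWithin w I r = deriv w r := fun r hr =>
    derivWithin_of_mem_nhds (hnhds r hr)
  have hev : ∀ᶠ r : ℝ in 𝓝[>] 0, r ∈ Ioo 0 S := Ioo_mem_nhdsGT hS
  have hle : 𝓝[>] (0 : ℝ) ≤ 𝓝[I] 0 := by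
    rw [nhdsWithin_le_iff]
    exact mem_of_superset hev (Ioo_subset_Icc_self.trans hsub)
  have hc1 : ContinuousOn (derivWithin w I) I :=
    hw.smooth.continuousOn_derivWithin hu (by exact_mod_cast le_top)
  have hhas : ∀ r ∈ Ioo 0 S, HasDerivAt w (deriv w r) r := fun r hr =>
    ((hw.smooth.differentiableOn (by simp)).differentiableAt (hnhds r hr)).hasDerivAt
  have htd : Tendsto (deriv w) (𝓝[>] 0) (𝓝 1) := by
    have := (hc1 0 h0I).tendsto.mono_left hle
    rw [hw.deriv_zero] at this
    exact this.congr' (hev.mono hder)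
  have hwc : Tendsto w (𝓝[>] 0) (𝓝 0) := by
    have := (hw.smooth.continuousOn 0 h0I).tendsto.mono_left hle
    rwa [hw.zero] at this
  have hd2 : HasDerivWithinAt (derivWithin w I) 0 I 0 := by
    have h1 : DifferentiableWithinAt ℝ (derivWithin w I) I 0 :=
      ((hw.smooth.derivWithin hu (m := 1) (by norm_cast)).differentiableOn (by simp)) 0 h0I
    have h2 := hw.even_deriv_zero 2 (by decide)
    rw [iteratedDerivWithin_succ, iteratedDerivWithin_one] at h2
    have h3 := h1.hasDerivWithinAt
    rwa [h2] at h3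
  refine ⟨hS, hw.zero, fun r hr => hw.pos r (hsub ⟨hr.1.le, hr.2.le⟩) hr.1, hhas, ?_, htd, ?_⟩
  · exact (hc1.mono (Ioo_subset_Icc_self.trans hsub)).congr fun r hr => (hder r hr).symm
  -- Half the difference quotient of `w'` at `0`; it is the quotient of derivatives for `(w(r) - r)
  -- / r²`.
  · have hq : Tendsto (fun r => (deriv w r - 1) / (2 * r)) (𝓝[>] 0) (𝓝 0) := by
      have := (hasDerivWithinAt_iff_tendsto_slope.1 hd2).mono_left (nhdsWithin_mono 0 (s := Ioo 0 S) fun r hr =>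
        (⟨hsub ⟨hr.1.le, hr.2.le⟩, hr.1.ne'⟩ : r ∈ I \ {0}))
      rw [nhdsWithin_Ioo_eq_nhdsGT hS] at this
      have h2 := this.const_mul (1 / 2)
      rw [mul_zero] at h2
      refine h2.congr' (hev.mono fun r hr => ?_)
      rw [slope_def_field, hder r hr, hw.deriv_zero]
      have := hr.1.ne'
      field_simp
      ring
    have := HasDerivAt.lhopital_zero_nhdsGT (f := fun r => w r - r) (g := fun r => r ^ 2)
      (f' := fun r => deriv w r - 1) (g' := fun r => 2 * r) (a := 0) (l := 𝓝 0)
      (hev.mono fun r hr => (hhas r hr).sub (hasDerivAt_id r))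
      (hev.mono fun r hr => by simpa using hasDerivAt_pow 2 r)
      (hev.mono fun r hr => by have := hr.1; positivity)
      (by simpa using hwc.sub (tendsto_id.mono_left nhdsWithin_le_nhds))
      (by
        have : Tendsto (fun r : ℝ => r ^ 2) (𝓝 0) (𝓝 (0 ^ 2)) := (continuous_pow 2).tendsto 0
        simpa using this.mono_left nhdsWithin_le_nhds)
      hq
    refine this.congr' (hev.mono fun r hr => ?_)
    have := hr.1.ne'
    field_simp

namespace IsRegularWarp

variable {w : ℝ → ℝ} {S : ℝ}

theorem warpRatio_pos (hw : IsRegularWarp w S) {r : ℝ} (hr : r ∈ Ico 0 S) : 0 < warpRatio w r := by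
  rcases hr.1.eq_or_lt with h | h
  · rw [← h, warpRatio_zero]; exact one_pos
  · rw [warpRatio_of_ne w h.ne']
    exact div_pos (hw.pos r ⟨h, hr.2⟩) h

theorem hasDerivAt_warpRatio (hw : IsRegularWarp w S) {r : ℝ} (hr : r ∈ Ioo 0 S) :
    HasDerivAt (warpRatio w) ((deriv w r * r - w r) / r ^ 2) r := by
  have h := (hw.hasDerivAt r hr).div (hasDerivAt_id r) hr.1.ne'
  simp only [id, mul_one] at h
  refine h.congr_of_eventuallyEq ?_
  filter_upwards [Ioi_mem_nhds hr.1] with s hs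
  exact warpRatio_of_ne w (ne_of_gt hs)

theorem isLittleO_warpRatio_norm_sub_one (hw : IsRegularWarp w S) (E : Type*)
    [NormedAddCommGroup E] :
    (fun y : E => warpRatio w ‖y‖ - 1) =o[𝓝 0] fun y => y := by
  rw [Asymptotics.isLittleO_iff]
  intro c hc
  have h := (Metric.tendsto_nhds.1 hw.tendsto_warpRatio) c hc
  rw [eventually_nhdsWithin_iff] at h
  have hn : Tendsto (fun y : E => ‖y‖) (𝓝 0) (𝓝 0) := by
    simpa using (continuous_norm (E := E)).tendsto 0
  filter_upwards [hn.eventually h] with y hy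
  rcases (norm_nonneg y).eq_or_lt with h0 | h0
  · simp [← h0, warpRatio_zero]
  · have := hy h0
    rw [dist_zero_right, norm_div, norm_norm, div_lt_iff₀ h0] at this
    rw [warpRatio_of_ne w h0.ne']
    exact this.le

/-- `w(r)/r - 1 = o(r)` outweighs the corner of the norm at the origin. -/
theorem hasFDerivAt_warpRatio_norm_zero (hw : IsRegularWarp w S) (E : Type*)
    [NormedAddCommGroup E] [NormedSpace ℝ E] :
    HasFDerivAt (fun y : E => warpRatio w ‖y‖) (0 : E →L[ℝ] ℝ) 0 := by
  refine HasFDerivAt.of_isLittleO ?_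
  simpa [warpRatio_zero] using hw.isLittleO_warpRatio_norm_sub_one E

theorem differentiableAt_warpRatio_norm (hw : IsRegularWarp w S) {E : Type*}
    [NormedAddCommGroup E] [InnerProductSpace ℝ E] {x : E} (hx : ‖x‖ < S) :
    DifferentiableAt ℝ (fun y : E => warpRatio w ‖y‖) x := by
  by_cases h0 : x = 0
  · rw [h0]; exact (hw.hasFDerivAt_warpRatio_norm_zero E).differentiableAt
  · exact DifferentiableAt.comp x
      (hw.hasDerivAt_warpRatio ⟨norm_pos_iff.2 h0, hx⟩).differentiableAt
      (differentiableAt_id.norm ℝ h0)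

/-- The coefficients `√(det g) g^{ij}` of the Laplacian are differentiable. -/
theorem differentiableAt_coeff (hw : IsRegularWarp w S) {m : ℕ} (hm : 1 ≤ m)
    {x : EuclideanSpace ℝ (Fin m)} (hx : ‖x‖ < S) (i j : Fin m) :
    DifferentiableAt ℝ
      (fun y => volumeDensity (modelMetric m w) y * (modelMetric m w y)⁻¹ i j) x := by
  have hh := hw.differentiableAt_warpRatio_norm hx
  have hpos : ∀ y : EuclideanSpace ℝ (Fin m), ‖y‖ < S → 0 < warpRatio w ‖y‖ := fun y hy =>
    hw.warpRatio_pos ⟨norm_nonneg y, hy⟩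
  have hev : ∀ᶠ y : EuclideanSpace ℝ (Fin m) in 𝓝 x, ‖y‖ < S :=
    (continuous_norm.tendsto x).eventually (gt_mem_nhds hx)
  have hmain : (fun y => volumeDensity (modelMetric m w) y * (modelMetric m w y)⁻¹ i j) =ᶠ[𝓝 x]
      fun y => warpRatio w ‖y‖ ^ (m - 1) * ((warpRatio w ‖y‖ ^ 2)⁻¹ *
        (1 : Matrix (Fin m) (Fin m) ℝ) i j) +
        (warpRatio w ‖y‖ ^ (m - 1) * (1 - (warpRatio w ‖y‖ ^ 2)⁻¹)) * radialProj y i j := by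
    filter_upwards [hev] with y hy
    rw [volumeDensity_modelMetric hm w (hpos y hy), modelMetric_inv w (hpos y hy).ne']
    simp only [Matrix.add_apply, Matrix.smul_apply, smul_eq_mul]
    ring
  refine DifferentiableAt.congr_of_eventuallyEq ?_ hmain
  have hinv : DifferentiableAt ℝ (fun y : EuclideanSpace ℝ (Fin m) => (warpRatio w ‖y‖ ^ 2)⁻¹) x :=
    (hh.pow 2).inv (pow_ne_zero 2 (hpos x hx).ne')
  refine ((hh.pow _).mul (hinv.mul_const _)).add ?_
  by_cases h0 : x = 0
  · subst h0
    -- `radialProj` is not continuous at the origin, but it is bounded, and its factor vanishes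
    -- there together with its derivative. Hence the product is `o(y)`.
    have hκ : HasFDerivAt (fun y : EuclideanSpace ℝ (Fin m) =>
        warpRatio w ‖y‖ ^ (m - 1) * (1 - (warpRatio w ‖y‖ ^ 2)⁻¹))
        (0 : EuclideanSpace ℝ (Fin m) →L[ℝ] ℝ) 0 := by
      have hz := hw.hasFDerivAt_warpRatio_norm_zero (EuclideanSpace ℝ (Fin m))
      have hd : HasDerivAt (fun t : ℝ => t ^ (m - 1) * (1 - (t ^ 2)⁻¹))
          (deriv (fun t : ℝ => t ^ (m - 1) * (1 - (t ^ 2)⁻¹)) (warpRatio w ‖(0 : EuclideanSpace ℝ (Fin m))‖))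
          (warpRatio w ‖(0 : EuclideanSpace ℝ (Fin m))‖) := by
        refine DifferentiableAt.hasDerivAt ?_
        rw [norm_zero, warpRatio_zero]
        exact ((differentiableAt_id.pow _).mul ((differentiableAt_const _).sub
          ((differentiableAt_id.pow 2).inv (by norm_num))))
      have hc := hd.comp_hasFDerivAt 0 hz
      rw [smul_zero] at hc
      exact hc
    refine HasFDerivAt.differentiableAt (f' := 0) (HasFDerivAt.of_isLittleO ?_)
    have hκ' := hκ.isLittleO
    simp only [norm_zero, warpRatio_zero, one_pow, inv_one, sub_self, mul_zero, sub_zero,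
      zero_apply, zero_mul] at hκ' ⊢
    refine (Asymptotics.isBigO_of_le _ fun y => ?_).trans_isLittleO hκ'
    rw [norm_mul]
    exact mul_le_of_le_one_right (norm_nonneg _) (abs_radialProj_apply_le y i j)
  · refine ((hh.pow _).mul ((differentiableAt_const _).sub hinv)).mul ?_
    simp only [radialProj_apply]
    have h1 : DifferentiableAt ℝ (fun y : EuclideanSpace ℝ (Fin m) => y i * y j) x := by fun_prop
    have h2 : DifferentiableAt ℝ (fun y : EuclideanSpace ℝ (Fin m) => ‖y‖ ^ 2) x :=
      (differentiableAt_id.norm ℝ h0).pow 2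
    have h3 : ‖x‖ ^ 2 ≠ 0 := pow_ne_zero 2 (norm_ne_zero_iff.2 h0)
    simp only [div_eq_mul_inv]
    exact h1.mul (h2.inv h3)

end IsRegularWarp

/-! ### The Laplace-Beltrami operator on `C²` functions -/

theorem partialDeriv_congr {m : ℕ} {u v : EuclideanSpace ℝ (Fin m) → ℝ}
    {x : EuclideanSpace ℝ (Fin m)} (h : u =ᶠ[𝓝 x] v) (i : Fin m) :
    partialDeriv i u =ᶠ[𝓝 x] partialDeriv i v :=
  h.fderiv.mono fun y hy => by rw [partialDeriv, partialDeriv, hy]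

theorem laplaceBeltrami_congr {m : ℕ} (g : EuclideanSpace ℝ (Fin m) → Matrix (Fin m) (Fin m) ℝ)
    {u v : EuclideanSpace ℝ (Fin m) → ℝ} {x : EuclideanSpace ℝ (Fin m)} (h : u =ᶠ[𝓝 x] v) :
    laplaceBeltrami g u x = laplaceBeltrami g v x := by
  unfold laplaceBeltrami
  congr 1
  refine Finset.sum_congr rfl fun i _ => (partialDeriv_congr ?_ i).eq_of_nhds
  filter_upwards [eventually_all.2 (partialDeriv_congr h)] with y hy
  simp only [hy]

theorem partialDeriv_lincomb {m : ℕ} {u v : EuclideanSpace ℝ (Fin m) → ℝ}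
    {x : EuclideanSpace ℝ (Fin m)} (hu : DifferentiableAt ℝ u x) (hv : DifferentiableAt ℝ v x)
    (a b : ℝ) (i : Fin m) :
    partialDeriv i (fun y => a * u y + b * v y) x =
      a * partialDeriv i u x + b * partialDeriv i v x := by
  have h := (hu.hasFDerivAt.const_mul a).fun_add (hv.hasFDerivAt.const_mul b)
  unfold partialDeriv
  rw [HasFDerivAt.fderiv h]
  simp

theorem differentiableAt_fderiv {E : Type*} [NormedAddCommGroup E] [NormedSpace ℝ E] {u : E → ℝ}
    {x : E} (hu : ContDiffAt ℝ 2 u x) : DifferentiableAt ℝ (fderiv ℝ u) x :=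
  (hu.fderiv_right (m := 1) (by norm_num)).differentiableAt (by simp)

theorem differentiableAt_partialDeriv {m : ℕ} {u : EuclideanSpace ℝ (Fin m) → ℝ}
    {x : EuclideanSpace ℝ (Fin m)} (hu : ContDiffAt ℝ 2 u x) (i : Fin m) :
    DifferentiableAt ℝ (partialDeriv i u) x :=
  (differentiableAt_fderiv hu).clm_apply (differentiableAt_const _)

theorem partialDeriv_partialDeriv {m : ℕ} {u : EuclideanSpace ℝ (Fin m) → ℝ}
    {x : EuclideanSpace ℝ (Fin m)} (hu : ContDiffAt ℝ 2 u x) (i j : Fin m) :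
    partialDeriv i (partialDeriv j u) x =
      fderiv ℝ (fderiv ℝ u) x (EuclideanSpace.single i 1) (EuclideanSpace.single j 1) := by
  have h := (differentiableAt_fderiv hu).hasFDerivAt.clm_apply
    (hasFDerivAt_const (EuclideanSpace.single j (1 : ℝ)) x)
  rw [partialDeriv, show partialDeriv j u = fun y => fderiv ℝ u y (EuclideanSpace.single j 1) from
    rfl, h.fderiv]
  simp

/-- The Laplace-Beltrami operator, expanded by the product rule. -/
theorem laplaceBeltrami_eq {m : ℕ} {g : EuclideanSpace ℝ (Fin m) → Matrix (Fin m) (Fin m) ℝ}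
    {u : EuclideanSpace ℝ (Fin m) → ℝ} {x : EuclideanSpace ℝ (Fin m)}
    (hg : ∀ i j, DifferentiableAt ℝ (fun y => volumeDensity g y * (g y)⁻¹ i j) x)
    (hu : ContDiffAt ℝ 2 u x) :
    laplaceBeltrami g u x = (volumeDensity g x)⁻¹ * ∑ i, ∑ j,
      (partialDeriv i (fun y => volumeDensity g y * (g y)⁻¹ i j) x * partialDeriv j u x +
        volumeDensity g x * (g x)⁻¹ i j * partialDeriv i (partialDeriv j u) x) := by
  unfold laplaceBeltrami
  congr 1
  refine Finset.sum_congr rfl fun i _ => ?_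
  have h : HasFDerivAt (fun y => ∑ j, (volumeDensity g y * (g y)⁻¹ i j) * partialDeriv j u y) _ x :=
    HasFDerivAt.fun_sum fun j (_ : j ∈ Finset.univ) =>
      (hg i j).hasFDerivAt.mul (differentiableAt_partialDeriv hu j).hasFDerivAt
  simp only [Finset.mul_sum, ← mul_assoc]
  rw [partialDeriv, h.fderiv]
  simp only [_root_.sum_apply, _root_.add_apply,
    _root_.smul_apply, smul_eq_mul]
  refine Finset.sum_congr rfl fun j _ => ?_
  unfold partialDeriv
  ring

theorem laplaceBeltrami_lincomb {m : ℕ}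
    {g : EuclideanSpace ℝ (Fin m) → Matrix (Fin m) (Fin m) ℝ}
    {u v : EuclideanSpace ℝ (Fin m) → ℝ} {x : EuclideanSpace ℝ (Fin m)}
    (hg : ∀ i j, DifferentiableAt ℝ (fun y => volumeDensity g y * (g y)⁻¹ i j) x)
    (hu : ContDiffAt ℝ 2 u x) (hv : ContDiffAt ℝ 2 v x) (a b : ℝ) :
    laplaceBeltrami g (fun y => a * u y + b * v y) x =
      a * laplaceBeltrami g u x + b * laplaceBeltrami g v x := by
  have hd : ∀ {f : EuclideanSpace ℝ (Fin m) → ℝ}, ContDiffAt ℝ 2 f x →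
      ∀ᶠ y in 𝓝 x, DifferentiableAt ℝ f y := fun hf =>
    (hf.eventually (by simp)).mono fun y hy => hy.differentiableAt (by simp)
  have h1 : ∀ j, partialDeriv j (fun y => a * u y + b * v y) =ᶠ[𝓝 x]
      fun y => a * partialDeriv j u y + b * partialDeriv j v y := fun j => by
    filter_upwards [hd hu, hd hv] with y hy hy'
    exact partialDeriv_lincomb hy hy' a b j
  have h2 : ∀ i j, partialDeriv i (partialDeriv j (fun y => a * u y + b * v y)) x =
      a * partialDeriv i (partialDeriv j u) x + b * partialDeriv i (partialDeriv j v) x :=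
    fun i j => by
      rw [(partialDeriv_congr (h1 j) i).eq_of_nhds]
      exact partialDeriv_lincomb (differentiableAt_partialDeriv hu j)
        (differentiableAt_partialDeriv hv j) a b i
  have huv : ContDiffAt ℝ 2 (fun y => a * u y + b * v y) x :=
    (contDiffAt_const.mul hu).add (contDiffAt_const.mul hv)
  rw [laplaceBeltrami_eq hg hu, laplaceBeltrami_eq hg hv, laplaceBeltrami_eq hg huv]
  simp only [h2, (h1 _).eq_of_nhds]
  rw [mul_left_comm a, mul_left_comm b, ← mul_add]
  congr 1
  simp only [Finset.mul_sum, ← Finset.sum_add_distrib]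
  refine Finset.sum_congr rfl fun i _ => Finset.sum_congr rfl fun j _ => ?_
  ring

/-- Restrict to the line through `x` along `v`. If the second derivative were negative, the second
derivative test would make the minimum also a local maximum; the restriction would then be locally
constant and its second derivative zero. -/
theorem hessian_nonneg_of_isLocalMin {E : Type*} [NormedAddCommGroup E] [NormedSpace ℝ E]
    {u : E → ℝ} {x : E} (hu : ContDiffAt ℝ 2 u x) (hmin : IsLocalMin u x) (v : E) :
    0 ≤ fderiv ℝ (fderiv ℝ u) x v v := by
  set ℓ : ℝ → E := fun t => x + t • v with hℓ
  have hℓ0 : ℓ 0 = x := by simp [hℓ]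
  have hℓd : ∀ t, HasDerivAt ℓ v t := fun t => by
    have := ((hasDerivAt_id t).smul_const v).const_add x
    rwa [one_smul] at this
  have hℓc : Tendsto ℓ (𝓝 0) (𝓝 x) := by
    have := (hℓd 0).continuousAt.tendsto
    rwa [hℓ0] at this
  have hev : ∀ᶠ y in 𝓝 x, DifferentiableAt ℝ u y :=
    (hu.eventually (by simp)).mono fun y hy => hy.differentiableAt (by simp)
  have h1 : deriv (u ∘ ℓ) =ᶠ[𝓝 0] fun t => fderiv ℝ u (ℓ t) v := by
    filter_upwards [hℓc.eventually hev] with t ht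
    exact (ht.hasFDerivAt.comp_hasDerivAt t (hℓd t)).deriv
  have h2 : deriv (deriv (u ∘ ℓ)) 0 = fderiv ℝ (fderiv ℝ u) x v v := by
    rw [h1.deriv_eq]
    have hF : HasFDerivAt (fderiv ℝ u) (fderiv ℝ (fderiv ℝ u) x) (ℓ 0) := by
      rw [hℓ0]; exact (differentiableAt_fderiv hu).hasFDerivAt
    have := (hF.comp_hasDerivAt (0 : ℝ) (hℓd 0)).clm_apply (hasDerivAt_const (0 : ℝ) v)
    simpa using this.deriv
  have hm : IsLocalMin (u ∘ ℓ) 0 := by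
    have := hℓc.eventually hmin
    rw [← hℓ0] at this
    exact this
  by_contra! hneg
  have hmax : IsLocalMax (u ∘ ℓ) 0 := by
    refine isLocalMax_of_deriv_deriv_neg (by rw [h2]; exact hneg) hm.deriv_eq_zero ?_
    have hc : ContinuousAt u (ℓ 0) := by rw [hℓ0]; exact hu.continuousAt
    exact hc.comp (hℓd 0).continuousAt
  have hconst : (u ∘ ℓ) =ᶠ[𝓝 0] fun _ => (u ∘ ℓ) 0 := by
    filter_upwards [hm, hmax] with t h h'
    exact le_antisymm h' h
  have : deriv (deriv (u ∘ ℓ)) 0 = 0 := by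
    rw [hconst.deriv.deriv_eq]
    simp
  rw [h2] at this
  exact hneg.ne this

-- Factor `N = Bᵀ B`: the sum becomes the quadratic form of `H` evaluated on the rows of `B` and
-- added up.
open scoped MatrixOrder in
theorem sum_mul_nonneg_of_posSemidef {n : Type*} [Fintype n] [DecidableEq n] {N H : Matrix n n ℝ}
    (hN : N.PosSemidef) (hH : ∀ v : n → ℝ, 0 ≤ ∑ i, ∑ j, v i * v j * H i j) :
    0 ≤ ∑ i, ∑ j, N i j * H i j := by
  obtain ⟨B, hB⟩ : ∃ B : Matrix n n ℝ, N = star B * B :=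
    CStarAlgebra.nonneg_iff_eq_star_mul_self.1 hN.nonneg
  rw [Matrix.star_eq_conjTranspose] at hB
  subst hB
  have : ∑ i, ∑ j, (B.conjTranspose * B) i j * H i j = ∑ k, ∑ i, ∑ j, B k i * B k j * H i j := by
    simp only [Matrix.mul_apply, Matrix.conjTranspose_apply, star_trivial, Finset.sum_mul]
    rw [Finset.sum_comm (s := Finset.univ (α := n)) (t := Finset.univ)
      (f := fun k i => ∑ j, B k i * B k j * H i j)]
    exact Finset.sum_congr rfl fun i _ => Finset.sum_comm
  rw [this]
  exact Finset.sum_nonneg fun k _ => hH (B k)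

/-- The gradient vanishes at a minimum, so only the contraction of `g⁻¹` with the Hessian survives,
and both are positive semidefinite. -/
theorem laplaceBeltrami_nonneg_of_isLocalMin {m : ℕ}
    {g : EuclideanSpace ℝ (Fin m) → Matrix (Fin m) (Fin m) ℝ}
    {u : EuclideanSpace ℝ (Fin m) → ℝ} {x : EuclideanSpace ℝ (Fin m)}
    (hg : ∀ i j, DifferentiableAt ℝ (fun y => volumeDensity g y * (g y)⁻¹ i j) x)
    (hpos : (g x).PosSemidef) (hu : ContDiffAt ℝ 2 u x) (hmin : IsLocalMin u x) :
    0 ≤ laplaceBeltrami g u x := by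
  have hD : 0 ≤ volumeDensity g x := Real.sqrt_nonneg _
  have hgrad : ∀ j, partialDeriv j u x = 0 := fun j => by
    rw [partialDeriv, hmin.fderiv_eq_zero]; simp
  rw [laplaceBeltrami_eq hg hu]
  simp only [hgrad, mul_zero, zero_add, mul_assoc, ← Finset.mul_sum]
  refine mul_nonneg (inv_nonneg.2 hD) (mul_nonneg hD ?_)
  refine sum_mul_nonneg_of_posSemidef (H := fun i j => partialDeriv i (partialDeriv j u) x)
    hpos.inv fun v => ?_
  have := hessian_nonneg_of_isLocalMin hu hmin (∑ i, v i • EuclideanSpace.single i (1 : ℝ))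
  simp only [map_sum, map_smul, _root_.sum_apply, _root_.smul_apply,
    smul_eq_mul, Finset.mul_sum] at this
  refine this.trans_eq ?_
  rw [Finset.sum_comm]
  refine Finset.sum_congr rfl fun i _ => Finset.sum_congr rfl fun j _ => ?_
  rw [partialDeriv_partialDeriv hu]
  ring

theorem modelMetric_posSemidef {m : ℕ} (w : ℝ → ℝ) (x : EuclideanSpace ℝ (Fin m)) :
    (modelMetric m w x).PosSemidef := by
  by_cases hx : x = 0
  · rw [hx, modelMetric_zero]; exact Matrix.PosSemidef.one
  refine Matrix.PosSemidef.of_dotProduct_mulVec_nonneg ?_ fun v => ?_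
  · ext i j
    rw [Matrix.conjTranspose_apply, star_trivial, modelMetric_apply_of_ne w hx,
      modelMetric_apply_of_ne w hx, mul_comm (x j), ← Matrix.transpose_apply 1, Matrix.transpose_one]
  · have h := modelMetric_quadForm w hx (WithLp.toLp 2 v)
    have h2 := inner_div_norm_sq_le hx (WithLp.toLp 2 v)
    have h3 : 0 ≤ ∑ i, ∑ j, modelMetric m w x i j * v i * v j := by
      refine le_of_le_of_eq ?_ h.symm
      exact add_nonneg (sq_nonneg _) (mul_nonneg (sq_nonneg _) (sub_nonneg.2 h2))
    refine h3.trans_eq ?_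
    simp only [dotProduct, Matrix.mulVec, star_trivial, Finset.mul_sum]
    refine Finset.sum_congr rfl fun i _ => Finset.sum_congr rfl fun j _ => ?_
    ring

/-! ### Primitives on half-open intervals -/

theorem intervalIntegrable_of_continuousOn_Ico {f : ℝ → ℝ} {S : ℝ} (hf : ContinuousOn f (Ico 0 S))
    {a b : ℝ} (ha : a ∈ Ico 0 S) (hb : b ∈ Ico 0 S) : IntervalIntegrable f volume a b :=
  (hf.mono (ordConnected_Ico.uIcc_subset ha hb)).intervalIntegrable

theorem continuousOn_primitive_Ico {f : ℝ → ℝ} {S : ℝ} (hf : ContinuousOn f (Ico 0 S)) :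
    ContinuousOn (fun r => ∫ s in (0 : ℝ)..r, f s) (Ico 0 S) := by
  intro r hr
  obtain ⟨c, hrc, hcS⟩ := exists_between hr.2
  have h0c : 0 ≤ c := hr.1.trans hrc.le
  have hsub : uIcc 0 c ⊆ Ico 0 S := by
    rw [uIcc_of_le h0c]; exact fun s hs => ⟨hs.1, hs.2.trans_lt hcS⟩
  have h := intervalIntegral.continuousOn_primitive_interval
    ((hf.mono hsub).integrableOn_compact isCompact_uIcc) (μ := volume)
  rw [uIcc_of_le h0c] at h
  refine (h r ⟨hr.1, hrc.le⟩).mono_of_mem_nhdsWithin ?_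
  filter_upwards [self_mem_nhdsWithin, mem_nhdsWithin_of_mem_nhds (Iio_mem_nhds hrc)] with s hs hs'
  exact ⟨hs.1, le_of_lt hs'⟩

theorem hasDerivAt_primitive_Ico {f : ℝ → ℝ} {S : ℝ} (hf : ContinuousOn f (Ico 0 S)) {r : ℝ}
    (hr : r ∈ Ioo 0 S) : HasDerivAt (fun r => ∫ s in (0 : ℝ)..r, f s) (f r) r := by
  have hf' := hf.mono Ioo_subset_Ico_self
  exact intervalIntegral.integral_hasDerivAt_right
    (intervalIntegrable_of_continuousOn_Ico hf ⟨le_rfl, hr.1.trans hr.2⟩ (Ioo_subset_Ico_self hr))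
    (hf'.stronglyMeasurableAtFilter isOpen_Ioo r hr) (hf'.continuousAt (isOpen_Ioo.mem_nhds hr))

theorem tendsto_nhdsGT_zero {f : ℝ → ℝ} {S : ℝ} (hS : 0 < S) (hf : ContinuousOn f (Ico 0 S)) :
    Tendsto f (𝓝[>] 0) (𝓝 (f 0)) := by
  rw [← nhdsWithin_Ioo_eq_nhdsGT hS]
  exact (hf 0 ⟨le_rfl, hS⟩).tendsto.mono_left (nhdsWithin_mono 0 Ioo_subset_Ico_self)

/-! ### The radial Green operator -/

/-- `∫₀ʳ w(s)ⁿ b(s) ds`. -/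
def radialMass (n : ℕ) (w b : ℝ → ℝ) (r : ℝ) : ℝ := ∫ s in (0 : ℝ)..r, w s ^ n * b s

/-- The radial flux `w(r)⁻ⁿ ∫₀ʳ w(s)ⁿ b(s) ds`. -/
def radialFlux (n : ℕ) (w b : ℝ → ℝ) (r : ℝ) : ℝ := radialMass n w b r / w r ^ n

/-- The solution `a` of `(wⁿ a')' + wⁿ b = 0` on `[0, R]` which is regular at `0` and vanishes at
`R`. -/
def radialGreen (n : ℕ) (w : ℝ → ℝ) (R : ℝ) (b : ℝ → ℝ) (r : ℝ) : ℝ :=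
  ∫ s in r..R, radialFlux n w b s

theorem radialFlux_zero (n : ℕ) (w b : ℝ → ℝ) : radialFlux n w b 0 = 0 := by
  simp [radialFlux, radialMass]

theorem radialGreen_self (n : ℕ) (w : ℝ → ℝ) (R : ℝ) (b : ℝ → ℝ) : radialGreen n w R b R = 0 := by
  simp [radialGreen]

namespace IsRegularWarp

variable {w : ℝ → ℝ} {S : ℝ}

theorem eventually_mem_Ioo (hw : IsRegularWarp w S) : ∀ᶠ r in 𝓝[>] (0 : ℝ), r ∈ Ioo 0 S :=
  Ioo_mem_nhdsGT hw.S_pos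

theorem tendsto_div_self (hw : IsRegularWarp w S) :
    Tendsto (fun r => w r / r) (𝓝[>] 0) (𝓝 1) := by
  have h := (hw.tendsto_warpRatio.mul
    ((tendsto_id (α := ℝ) (x := 𝓝 0)).mono_left nhdsWithin_le_nhds)).add_const 1
  simp only [zero_mul, zero_add] at h
  refine h.congr' ?_
  filter_upwards [self_mem_nhdsWithin] with r hr
  have : r ≠ 0 := ne_of_gt hr
  simp only [id]
  field_simp
  ring

theorem continuousOn (hw : IsRegularWarp w S) : ContinuousOn w (Ico 0 S) := by
  intro r hr
  rcases hr.1.eq_or_lt with h | h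
  · subst h
    have h1 := hw.tendsto_div_self.mul
      ((tendsto_id (α := ℝ) (x := 𝓝 0)).mono_left nhdsWithin_le_nhds)
    rw [mul_zero] at h1
    have h2 : Tendsto w (𝓝[>] 0) (𝓝 (w 0)) := by
      rw [hw.zero]
      refine h1.congr' ?_
      filter_upwards [self_mem_nhdsWithin] with r hr
      have : r ≠ 0 := ne_of_gt hr
      simp only [id]
      field_simp
    have h3 : ContinuousWithinAt w (Ici 0) 0 := by
      rw [← continuousWithinAt_Ioi_iff_Ici]; exact h2
    exact h3.mono Ico_subset_Ici_self
  · exact (hw.hasDerivAt r ⟨h, hr.2⟩).continuousAt.continuousWithinAt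

theorem continuousOn_pow_mul (hw : IsRegularWarp w S) (n : ℕ) {b : ℝ → ℝ}
    (hb : ContinuousOn b (Ico 0 S)) : ContinuousOn (fun s => w s ^ n * b s) (Ico 0 S) :=
  (hw.continuousOn.pow n).mul hb

theorem pow_pos (hw : IsRegularWarp w S) (n : ℕ) {r : ℝ} (hr : r ∈ Ioo 0 S) : 0 < w r ^ n :=
  _root_.pow_pos (hw.pos r hr) n

theorem hasDerivAt_radialMass (hw : IsRegularWarp w S) (n : ℕ) {b : ℝ → ℝ}
    (hb : ContinuousOn b (Ico 0 S)) {r : ℝ} (hr : r ∈ Ioo 0 S) :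
    HasDerivAt (radialMass n w b) (w r ^ n * b r) r :=
  hasDerivAt_primitive_Ico (hw.continuousOn_pow_mul n hb) hr

theorem continuousOn_radialMass (hw : IsRegularWarp w S) (n : ℕ) {b : ℝ → ℝ}
    (hb : ContinuousOn b (Ico 0 S)) : ContinuousOn (radialMass n w b) (Ico 0 S) :=
  continuousOn_primitive_Ico (hw.continuousOn_pow_mul n hb)

/-- Near `0` the integrand is asymptotic to `b(0) rⁿ`, as `w(r) / r → 1`; l'Hôpital's rule
integrates this. -/
theorem tendsto_radialMass_div (hw : IsRegularWarp w S) (n : ℕ) {b : ℝ → ℝ}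
    (hb : ContinuousOn b (Ico 0 S)) :
    Tendsto (fun r => radialMass n w b r / r ^ (n + 1)) (𝓝[>] 0) (𝓝 (b 0 / (n + 1))) := by
  refine HasDerivAt.lhopital_zero_nhdsGT (f' := fun r => w r ^ n * b r)
    (g' := fun r => ((n : ℝ) + 1) * r ^ n)
    (hw.eventually_mem_Ioo.mono fun r hr => hw.hasDerivAt_radialMass n hb hr)
    (hw.eventually_mem_Ioo.mono fun r hr => by simpa using hasDerivAt_pow (n + 1) r)
    (hw.eventually_mem_Ioo.mono fun r hr => by have := hr.1; positivity) ?_ ?_ ?_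
  · simpa [radialMass] using tendsto_nhdsGT_zero hw.S_pos (hw.continuousOn_radialMass n hb)
  · simpa using tendsto_nhdsGT_zero (f := fun r => r ^ (n + 1)) hw.S_pos (by fun_prop)
  · have := ((hw.tendsto_div_self.pow n).mul (tendsto_nhdsGT_zero hw.S_pos hb)).div_const ((n : ℝ) + 1)
    rw [one_pow, one_mul] at this
    refine this.congr' (hw.eventually_mem_Ioo.mono fun r hr => ?_)
    have := hr.1.ne'
    rw [div_pow]
    field_simp

theorem tendsto_radialFlux_div (hw : IsRegularWarp w S) (n : ℕ) {b : ℝ → ℝ}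
    (hb : ContinuousOn b (Ico 0 S)) :
    Tendsto (fun r => radialFlux n w b r / r) (𝓝[>] 0) (𝓝 (b 0 / (n + 1))) := by
  have h := (hw.tendsto_radialMass_div n hb).div (hw.tendsto_div_self.pow n) (by simp)
  rw [one_pow, div_one] at h
  refine h.congr' (hw.eventually_mem_Ioo.mono fun r hr => ?_)
  have := hr.1.ne'
  have := (hw.pos r hr).ne'
  simp only [Pi.div_apply, radialFlux, div_pow]
  field_simp
  ring

/-- Only the pole needs care: the flux is `O(r)` there, which matches the value `0` of the quotient
at `r = 0`. -/
theorem continuousOn_radialFlux (hw : IsRegularWarp w S) (n : ℕ) {b : ℝ → ℝ}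
    (hb : ContinuousOn b (Ico 0 S)) : ContinuousOn (radialFlux n w b) (Ico 0 S) := by
  intro r hr
  rcases hr.1.eq_or_lt with h | h
  · subst h
    have h1 := (hw.tendsto_radialFlux_div n hb).mul
      ((tendsto_id (α := ℝ) (x := 𝓝 0)).mono_left nhdsWithin_le_nhds)
    rw [mul_zero] at h1
    have h2 : Tendsto (radialFlux n w b) (𝓝[>] 0) (𝓝 (radialFlux n w b 0)) := by
      rw [radialFlux_zero]
      refine h1.congr' (hw.eventually_mem_Ioo.mono fun r hr => ?_)
      have := hr.1.ne'
      simp only [id]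
      field_simp
    have h3 : ContinuousWithinAt (radialFlux n w b) (Ici 0) 0 := by
      rw [← continuousWithinAt_Ioi_iff_Ici]; exact h2
    exact h3.mono Ico_subset_Ici_self
  · exact ((hw.continuousOn_radialMass n hb) r hr).div ((hw.continuousOn.pow n) r hr)
      (hw.pow_pos n ⟨h, hr.2⟩).ne'

/-- As the flux is `-a'` for `a = radialGreen n w R b`, this is the radial equation `a'' + n (w'/w)
a' = -b`. -/
theorem hasDerivAt_radialFlux (hw : IsRegularWarp w S) (n : ℕ) {b : ℝ → ℝ}
    (hb : ContinuousOn b (Ico 0 S)) {r : ℝ} (hr : r ∈ Ioo 0 S) :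
    HasDerivAt (radialFlux n w b) (b r - n * (deriv w r / w r) * radialFlux n w b r) r := by
  have hwr := (hw.pos r hr).ne'
  have h := (hw.hasDerivAt_radialMass n hb hr).div ((hw.hasDerivAt r hr).pow n)
    (hw.pow_pos n hr).ne'
  refine h.congr_deriv ?_
  rw [radialFlux]
  rcases n with - | k
  · simp
  · simp only [Pi.pow_apply, Nat.add_sub_cancel]
    field_simp
    ring

theorem radialGreen_eq (hw : IsRegularWarp w S) (n : ℕ) {b : ℝ → ℝ}
    (hb : ContinuousOn b (Ico 0 S)) {R : ℝ} (hR : R ∈ Ico 0 S) {r : ℝ} (hr : r ∈ Ico 0 S) :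
    radialGreen n w R b r = (∫ s in (0 : ℝ)..R, radialFlux n w b s) -
      ∫ s in (0 : ℝ)..r, radialFlux n w b s := by
  have hc := hw.continuousOn_radialFlux n hb
  have h0 : (0 : ℝ) ∈ Ico 0 S := ⟨le_rfl, hw.S_pos⟩
  exact (intervalIntegral.integral_interval_sub_left
    (intervalIntegrable_of_continuousOn_Ico hc h0 hR)
    (intervalIntegrable_of_continuousOn_Ico hc h0 hr)).symm

theorem continuousOn_radialGreen (hw : IsRegularWarp w S) (n : ℕ) {b : ℝ → ℝ}
    (hb : ContinuousOn b (Ico 0 S)) {R : ℝ} (hR : R ∈ Ico 0 S) :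
    ContinuousOn (radialGreen n w R b) (Ico 0 S) :=
  (continuousOn_const.sub (continuousOn_primitive_Ico (hw.continuousOn_radialFlux n hb))).congr
    fun _ hr => hw.radialGreen_eq n hb hR hr

theorem hasDerivAt_radialGreen (hw : IsRegularWarp w S) (n : ℕ) {b : ℝ → ℝ}
    (hb : ContinuousOn b (Ico 0 S)) {R : ℝ} (hR : R ∈ Ico 0 S) {r : ℝ} (hr : r ∈ Ioo 0 S) :
    HasDerivAt (radialGreen n w R b) (-radialFlux n w b r) r := by
  have h := (hasDerivAt_primitive_Ico (hw.continuousOn_radialFlux n hb) hr).const_sub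
    (∫ s in (0 : ℝ)..R, radialFlux n w b s)
  refine h.congr_of_eventuallyEq ?_
  filter_upwards [isOpen_Ioo.mem_nhds hr] with s hs
  exact hw.radialGreen_eq n hb hR (Ioo_subset_Ico_self hs)

end IsRegularWarp

/-- `radialFlux r / r`, continued to `0`. -/
def radialSlope (n : ℕ) (w b : ℝ → ℝ) (r : ℝ) : ℝ :=
  if r = 0 then b 0 / (n + 1) else radialFlux n w b r / r

theorem radialSlope_of_ne (n : ℕ) (w b : ℝ → ℝ) {r : ℝ} (hr : r ≠ 0) :
    radialSlope n w b r = radialFlux n w b r / r := by simp [radialSlope, hr]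

theorem radialSlope_zero (n : ℕ) (w b : ℝ → ℝ) : radialSlope n w b 0 = b 0 / (n + 1) := by
  simp [radialSlope]

theorem radialSlope_mul (n : ℕ) (w b : ℝ → ℝ) (r : ℝ) :
    radialSlope n w b r * r = radialFlux n w b r := by
  by_cases hr : r = 0
  · simp [hr, radialFlux_zero]
  · rw [radialSlope_of_ne _ _ _ hr, div_mul_cancel₀ _ hr]

/-- The derivative of `radialSlope`. -/
def radialSlopeDeriv (n : ℕ) (w b : ℝ → ℝ) (r : ℝ) : ℝ :=
  (b r - (n * (r * deriv w r / w r) + 1) * radialSlope n w b r) / r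

namespace IsRegularWarp

variable {w : ℝ → ℝ} {S : ℝ}

theorem hasDerivAt_radialSlope (hw : IsRegularWarp w S) (n : ℕ) {b : ℝ → ℝ}
    (hb : ContinuousOn b (Ico 0 S)) {r : ℝ} (hr : r ∈ Ioo 0 S) :
    HasDerivAt (radialSlope n w b) (radialSlopeDeriv n w b r) r := by
  have hr0 := hr.1.ne'
  have h := (hw.hasDerivAt_radialFlux n hb hr).div (hasDerivAt_id r) hr0
  have h' : radialSlope n w b =ᶠ[𝓝 r] (radialFlux n w b / id) := by
    filter_upwards [Ioi_mem_nhds hr.1] with s hs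
    exact radialSlope_of_ne n w b (ne_of_gt hs)
  refine (h.congr_of_eventuallyEq h').congr_deriv ?_
  rw [radialSlopeDeriv, radialSlope_of_ne _ _ _ hr0]
  have := (hw.pos r hr).ne'
  simp only [id, mul_one]
  field_simp
  ring

theorem continuousOn_radialSlope (hw : IsRegularWarp w S) (n : ℕ) {b : ℝ → ℝ}
    (hb : ContinuousOn b (Ico 0 S)) : ContinuousOn (radialSlope n w b) (Ico 0 S) := by
  intro r hr
  rcases hr.1.eq_or_lt with h | h
  · subst h
    have h2 : Tendsto (radialSlope n w b) (𝓝[>] 0) (𝓝 (radialSlope n w b 0)) := by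
      rw [radialSlope_zero]
      refine (hw.tendsto_radialFlux_div n hb).congr' (hw.eventually_mem_Ioo.mono fun r hr => ?_)
      exact (radialSlope_of_ne _ _ _ hr.1.ne').symm
    have h3 : ContinuousWithinAt (radialSlope n w b) (Ici 0) 0 := by
      rw [← continuousWithinAt_Ioi_iff_Ici]; exact h2
    exact h3.mono Ico_subset_Ici_self
  · exact (hw.hasDerivAt_radialSlope n hb ⟨h, hr.2⟩).continuousAt.continuousWithinAt

theorem continuousOn_radialSlopeDeriv (hw : IsRegularWarp w S) (n : ℕ) {b : ℝ → ℝ}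
    (hb : ContinuousOn b (Ico 0 S)) : ContinuousOn (radialSlopeDeriv n w b) (Ioo 0 S) := by
  have hs := Ioo_subset_Ico_self (a := (0 : ℝ)) (b := S)
  refine ((hb.mono hs).sub (((continuousOn_const.mul ((continuousOn_id.mul
    hw.continuousOn_deriv).div (hw.continuousOn.mono hs) fun r hr => (hw.pos r hr).ne')).add
    continuousOn_const).mul ((hw.continuousOn_radialSlope n hb).mono hs))).div continuousOn_id
    fun r hr => hr.1.ne'

/-- Since `r w'/w → 1` and the slope tends to `b(0)/(n+1)`, the numerator tends to `b(0) - (n+1)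
b(0)/(n+1) = 0`. The slope need not be differentiable at `0`: this weaker decay is what `C²`
regularity at the pole requires. -/
theorem tendsto_mul_radialSlopeDeriv (hw : IsRegularWarp w S) (n : ℕ) {b : ℝ → ℝ}
    (hb : ContinuousOn b (Ico 0 S)) :
    Tendsto (fun r => radialSlopeDeriv n w b r * r) (𝓝[>] 0) (𝓝 0) := by
  have h1 : Tendsto (fun r => r * deriv w r / w r) (𝓝[>] 0) (𝓝 1) := by
    have := hw.tendsto_deriv.div hw.tendsto_div_self one_ne_zero
    rw [div_one] at this
    refine this.congr' (hw.eventually_mem_Ioo.mono fun r hr => ?_)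
    have := hr.1.ne'
    have := (hw.pos r hr).ne'
    rw [Pi.div_apply]
    field_simp
  have h2 := (tendsto_nhdsGT_zero hw.S_pos hb).sub (((h1.const_mul (n : ℝ)).add_const 1).mul
    (tendsto_nhdsGT_zero hw.S_pos (hw.continuousOn_radialSlope n hb)))
  have h3 : b 0 - ((n : ℝ) * 1 + 1) * radialSlope n w b 0 = 0 := by
    rw [radialSlope_zero]
    field_simp
    ring
  rw [h3] at h2
  refine h2.congr' (hw.eventually_mem_Ioo.mono fun r hr => ?_)
  have := hr.1.ne'
  simp only [radialSlopeDeriv]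
  field_simp

end IsRegularWarp

/-! ### Radial functions and fields -/

section RadialFields

variable {E : Type*} [NormedAddCommGroup E] [InnerProductSpace ℝ E]

theorem hasFDerivAt_norm_of_ne {x : E} (hx : x ≠ 0) :
    HasFDerivAt (fun y : E => ‖y‖) (‖x‖⁻¹ • innerSL ℝ x) x := by
  have hn : ‖x‖ ≠ 0 := norm_ne_zero_iff.2 hx
  have h := (hasStrictFDerivAt_norm_sq x).hasFDerivAt.sqrt (by positivity)
  simp only [Real.sqrt_sq (norm_nonneg _)] at h
  refine h.congr_fderiv ?_
  ext v
  simp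
  field_simp

/-- The derivative of the radial vector field `y ↦ c ‖y‖ • y`. -/
def radialFieldDeriv (c c' : ℝ → ℝ) (x : E) : E →L[ℝ] E :=
  c ‖x‖ • ContinuousLinearMap.id ℝ E + (c' ‖x‖ / ‖x‖) • (innerSL ℝ x).smulRight x

/-- At the origin continuity of `c` suffices, because `(c(‖y‖) - c(0)) y = o(y)`; the second summand
of `radialFieldDeriv` is zero there. -/
theorem hasFDerivAt_radialField {c c' : ℝ → ℝ} {S : ℝ} (hc : ContinuousOn c (Ico 0 S))
    (hd : ∀ r ∈ Ioo 0 S, HasDerivAt c (c' r) r) {x : E} (hx : ‖x‖ < S) :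
    HasFDerivAt (fun y : E => c ‖y‖ • y) (radialFieldDeriv c c' x) x := by
  by_cases h0 : x = 0
  · subst h0
    refine HasFDerivAt.of_isLittleO ?_
    rw [norm_zero] at hx
    have hcz : Tendsto (fun y : E => c ‖y‖ - c 0) (𝓝 0) (𝓝 0) := by
      have h1 : Tendsto c (𝓝[Ico 0 S] 0) (𝓝 (c 0)) := hc 0 ⟨le_rfl, hx⟩
      have h2 : Tendsto (fun y : E => ‖y‖) (𝓝 0) (𝓝[Ico 0 S] 0) := by
        have h3 : Tendsto (fun y : E => ‖y‖) (𝓝 0) (𝓝 0) := by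
          simpa using (continuous_norm (E := E)).tendsto 0
        refine tendsto_nhdsWithin_iff.2 ⟨h3, ?_⟩
        filter_upwards [h3.eventually (gt_mem_nhds hx)] with y hy
        exact ⟨norm_nonneg y, hy⟩
      simpa using (h1.comp h2).sub_const (c 0)
    have h4 := ((Asymptotics.isLittleO_one_iff ℝ).2 hcz).smul_isBigO
      (Asymptotics.isBigO_refl (fun y : E => y) (𝓝 0))
    simp only [one_smul] at h4
    simpa [radialFieldDeriv, sub_smul] using h4
  · have hn : 0 < ‖x‖ := norm_pos_iff.2 h0
    have h1 : HasFDerivAt (fun y : E => c ‖y‖) (c' ‖x‖ • ‖x‖⁻¹ • innerSL ℝ x) x :=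
      (hd ‖x‖ ⟨hn, hx⟩).comp_hasFDerivAt x (hasFDerivAt_norm_of_ne h0)
    refine (h1.smul (hasFDerivAt_id x)).congr_fderiv ?_
    ext v
    simp [radialFieldDeriv, smul_smul, div_eq_mul_inv]

/-- The second summand has norm `|c'(r)| r`, so `h0` is what makes it continuous at the origin. -/
theorem continuousOn_radialFieldDeriv {c c' : ℝ → ℝ} {S : ℝ} (hc : ContinuousOn c (Ico 0 S))
    (hc' : ContinuousOn c' (Ioo 0 S)) (h0 : Tendsto (fun r => c' r * r) (𝓝[>] 0) (𝓝 0)) :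
    ContinuousOn (radialFieldDeriv c c' : E → E →L[ℝ] E) (Metric.ball 0 S) := by
  have hsm : Continuous fun x : E => (innerSL ℝ x).smulRight x := by
    have : Continuous fun x : E => (innerSL ℝ x) := (innerSL ℝ).continuous
    fun_prop
  have hmaps : MapsTo (fun x : E => ‖x‖) (Metric.ball 0 S) (Ico 0 S) := fun x hx =>
    ⟨norm_nonneg x, mem_ball_zero_iff.1 hx⟩
  refine ((hc.comp continuous_norm.continuousOn hmaps).smul continuousOn_const).add ?_
  intro x hx
  by_cases hx0 : x = 0
  · subst hx0
    refine ContinuousAt.continuousWithinAt ?_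
    rw [ContinuousAt]
    simp only [map_zero, ContinuousLinearMap.smulRight_zero, smul_zero]
    rw [Metric.tendsto_nhds]
    intro ε hε
    have h1 := (Metric.tendsto_nhds.1 h0) ε hε
    rw [eventually_nhdsWithin_iff] at h1
    have h3 : Tendsto (fun y : E => ‖y‖) (𝓝 0) (𝓝 0) := by
      simpa using (continuous_norm (E := E)).tendsto 0
    filter_upwards [h3.eventually h1] with y hy
    by_cases hy0 : y = 0
    · simp [hy0, hε]
    · have hn : 0 < ‖y‖ := norm_pos_iff.2 hy0
      have := hy hn
      rw [dist_zero_right] at this ⊢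
      refine lt_of_eq_of_lt ?_ this
      rw [norm_smul, ContinuousLinearMap.norm_smulRight_apply, innerSL_apply_norm, norm_div,
        norm_norm, norm_mul, norm_norm]
      field_simp
  · have hn : 0 < ‖x‖ := norm_pos_iff.2 hx0
    have hx' : ‖x‖ ∈ Ioo 0 S := ⟨hn, mem_ball_zero_iff.1 hx⟩
    refine ContinuousAt.continuousWithinAt (ContinuousAt.fun_smul ?_ hsm.continuousAt)
    have h1 : ContinuousAt c' ‖x‖ := hc'.continuousAt (isOpen_Ioo.mem_nhds hx')
    exact (ContinuousAt.comp (f := fun y : E => ‖y‖) h1 continuous_norm.continuousAt).div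
      continuous_norm.continuousAt hn.ne'

theorem contDiffOn_radialField {c c' : ℝ → ℝ} {S : ℝ} (hc : ContinuousOn c (Ico 0 S))
    (hd : ∀ r ∈ Ioo 0 S, HasDerivAt c (c' r) r) (hc' : ContinuousOn c' (Ioo 0 S))
    (h0 : Tendsto (fun r => c' r * r) (𝓝[>] 0) (𝓝 0)) :
    ContDiffOn ℝ 1 (fun y : E => c ‖y‖ • y) (Metric.ball 0 S) := by
  have hF : ∀ x ∈ Metric.ball (0 : E) S,
      HasFDerivAt (fun y : E => c ‖y‖ • y) (radialFieldDeriv c c' x) x := fun x hx =>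
    hasFDerivAt_radialField hc hd (mem_ball_zero_iff.1 hx)
  rw [show (1 : WithTop ℕ∞) = 0 + 1 by rfl, contDiffOn_succ_iff_fderiv_of_isOpen Metric.isOpen_ball]
  refine ⟨fun x hx => (hF x hx).differentiableAt.differentiableWithinAt, by simp, ?_⟩
  rw [contDiffOn_zero]
  exact (continuousOn_radialFieldDeriv hc hc' h0).congr fun x hx => (hF x hx).fderiv

/-- At the origin the one-sided derivative of `a` is the limit of `-c(r) r`, that is `0`, so `a(‖y‖)
- a(0) = o(‖y‖)`. -/
theorem hasFDerivAt_radial {a c : ℝ → ℝ} {S : ℝ} (ha : ContinuousOn a (Ico 0 S))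
    (hc : ContinuousOn c (Ico 0 S)) (hd : ∀ r ∈ Ioo 0 S, HasDerivAt a (-(c r * r)) r) {x : E}
    (hx : ‖x‖ < S) : HasFDerivAt (fun y : E => a ‖y‖) (-(innerSL ℝ (c ‖x‖ • x))) x := by
  by_cases h0 : x = 0
  · subst h0
    rw [norm_zero] at hx
    have hcr : ContinuousOn (fun r => -(c r * r)) (Ico 0 S) := (hc.mul continuousOn_id).neg
    have hder : HasDerivWithinAt a 0 (Ici 0) 0 := by
      refine hasDerivWithinAt_Ici_of_tendsto_deriv (s := Ioo 0 S)
        (fun r hr => (hd r hr).differentiableAt.differentiableWithinAt)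
        ((ha 0 ⟨le_rfl, hx⟩).mono Ioo_subset_Ico_self) (Ioo_mem_nhdsGT hx) ?_
      have := tendsto_nhdsGT_zero hx hcr
      rw [mul_zero, neg_zero] at this
      refine this.congr' ?_
      filter_upwards [Ioo_mem_nhdsGT hx] with r hr
      exact (hd r hr).deriv.symm
    have h2 : Tendsto (fun y : E => ‖y‖) (𝓝 0) (𝓝[Ici 0] 0) :=
      tendsto_nhdsWithin_iff.2 ⟨by simpa using (continuous_norm (E := E)).tendsto 0,
        Eventually.of_forall fun y => norm_nonneg y⟩
    have h3 := hder.hasFDerivWithinAt.isLittleO.comp_tendsto h2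
    refine HasFDerivAt.of_isLittleO ?_
    have h4 : (fun y : E => a ‖y‖ - a 0) =o[𝓝 0] fun y => ‖y‖ := by
      refine h3.congr (fun y => by simp) (fun y => by simp)
    simpa using h4.of_norm_right
  · refine ((hd ‖x‖ ⟨norm_pos_iff.2 h0, hx⟩).comp_hasFDerivAt x
      (hasFDerivAt_norm_of_ne h0)).congr_fderiv ?_
    have hn : ‖x‖ ≠ 0 := norm_ne_zero_iff.2 h0
    ext v
    simp
    field_simp

/-- The gradient is the radial field `-c(‖x‖) x`, which is `C¹` by `contDiffOn_radialField`. -/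
theorem contDiffOn_radial [FiniteDimensional ℝ E] {a c c' : ℝ → ℝ} {S : ℝ}
    (ha : ContinuousOn a (Ico 0 S)) (hc : ContinuousOn c (Ico 0 S))
    (hda : ∀ r ∈ Ioo 0 S, HasDerivAt a (-(c r * r)) r)
    (hd : ∀ r ∈ Ioo 0 S, HasDerivAt c (c' r) r) (hc' : ContinuousOn c' (Ioo 0 S))
    (h0 : Tendsto (fun r => c' r * r) (𝓝[>] 0) (𝓝 0)) :
    ContDiffOn ℝ 2 (fun y : E => a ‖y‖) (Metric.ball 0 S) := by
  have hF : ∀ x ∈ Metric.ball (0 : E) S,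
      HasFDerivAt (fun y : E => a ‖y‖) (-(innerSL ℝ (c ‖x‖ • x))) x := fun x hx =>
    hasFDerivAt_radial ha hc hda (mem_ball_zero_iff.1 hx)
  rw [show (2 : WithTop ℕ∞) = 1 + 1 by norm_num,
    contDiffOn_succ_iff_fderiv_of_isOpen Metric.isOpen_ball]
  refine ⟨fun x hx => (hF x hx).differentiableAt.differentiableWithinAt, by simp, ?_⟩
  rw [contDiffOn_clm_apply]
  intro v
  have h1 : ContDiffOn ℝ 1 (fun x : E => -inner ℝ (c ‖x‖ • x) v) (Metric.ball 0 S) :=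
    ((contDiffOn_radialField hc hd hc' h0).inner ℝ contDiffOn_const).neg
  refine h1.congr fun x hx => ?_
  rw [(hF x hx).fderiv]
  rfl

end RadialFields

theorem radialProj_mul_apply_sum {m : ℕ} (x : EuclideanSpace ℝ (Fin m)) (i : Fin m) :
    ∑ j, radialProj x i j * x j = x i := by
  by_cases hx : x = 0
  · simp [hx]
  have hn : ‖x‖ ≠ 0 := norm_ne_zero_iff.2 hx
  have : ∀ j, radialProj x i j * x j = x i / ‖x‖ ^ 2 * x j ^ 2 := fun j => by
    rw [radialProj_apply]; ring
  simp only [this]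
  rw [← Finset.mul_sum, ← EuclideanSpace.real_norm_sq_eq]
  field_simp

/-- The radial direction is an eigenvector of the metric with eigenvalue `1`. Radial functions
therefore have the same gradient for `g` as for the Euclidean metric. -/
theorem modelMetric_inv_mul_sum {m : ℕ} (w : ℝ → ℝ) {x : EuclideanSpace ℝ (Fin m)}
    (hx : warpRatio w ‖x‖ ≠ 0) (i : Fin m) : ∑ j, (modelMetric m w x)⁻¹ i j * x j = x i := by
  rw [modelMetric_inv w hx]
  simp only [Matrix.add_apply, Matrix.smul_apply, smul_eq_mul, add_mul, Finset.sum_add_distrib,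
    mul_assoc, ← Finset.mul_sum, radialProj_mul_apply_sum, Matrix.one_apply]
  simp
  ring

theorem sum_partialDeriv_radialField {m : ℕ} {c c' : ℝ → ℝ} {S : ℝ}
    (hc : ContinuousOn c (Ico 0 S)) (hd : ∀ r ∈ Ioo 0 S, HasDerivAt c (c' r) r)
    {x : EuclideanSpace ℝ (Fin m)} (hx : ‖x‖ < S) :
    ∑ i, partialDeriv i (fun y => c ‖y‖ * y i) x = m * c ‖x‖ + c' ‖x‖ * ‖x‖ := by
  have h : ∀ i, partialDeriv i (fun y => c ‖y‖ * y i) x =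
      c ‖x‖ + c' ‖x‖ / ‖x‖ * x i ^ 2 := fun i => by
    have h1 := (EuclideanSpace.proj (𝕜 := ℝ) i).hasFDerivAt.comp x
      (hasFDerivAt_radialField hc hd hx)
    have h2 : HasFDerivAt (fun y : EuclideanSpace ℝ (Fin m) => c ‖y‖ * y i)
      ((EuclideanSpace.proj (𝕜 := ℝ) i).comp (radialFieldDeriv c c' x)) x := h1
    rw [partialDeriv, h2.fderiv]
    simp [radialFieldDeriv, EuclideanSpace.inner_single_right, sq]
  simp only [h, Finset.sum_add_distrib, ← Finset.mul_sum, ← EuclideanSpace.real_norm_sq_eq]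
  simp
  by_cases h0 : x = 0
  · simp [h0]
  · have : ‖x‖ ≠ 0 := norm_ne_zero_iff.2 h0
    field_simp

namespace IsRegularWarp

variable {w : ℝ → ℝ} {S : ℝ}

theorem hasDerivAt_radialGreen' (hw : IsRegularWarp w S) (n : ℕ) {b : ℝ → ℝ}
    (hb : ContinuousOn b (Ico 0 S)) {R : ℝ} (hR : R ∈ Ico 0 S) {r : ℝ} (hr : r ∈ Ioo 0 S) :
    HasDerivAt (radialGreen n w R b) (-(radialSlope n w b r * r)) r := by
  rw [radialSlope_mul]
  exact hw.hasDerivAt_radialGreen n hb hR hr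

theorem contDiffOn_radialGreen_norm (hw : IsRegularWarp w S) (n : ℕ) {b : ℝ → ℝ}
    (hb : ContinuousOn b (Ico 0 S)) {R : ℝ} (hR : R ∈ Ico 0 S) {E : Type*} [NormedAddCommGroup E]
    [InnerProductSpace ℝ E] [FiniteDimensional ℝ E] :
    ContDiffOn ℝ 2 (fun y : E => radialGreen n w R b ‖y‖) (Metric.ball 0 S) :=
  contDiffOn_radial (hw.continuousOn_radialGreen n hb hR) (hw.continuousOn_radialSlope n hb)
    (fun _ hr => hw.hasDerivAt_radialGreen' n hb hR hr)
    (fun _ hr => hw.hasDerivAt_radialSlope n hb hr) (hw.continuousOn_radialSlopeDeriv n hb)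
    (hw.tendsto_mul_radialSlopeDeriv n hb)

/-- The case `E = ℝ` of the preceding lemma says that the even extension of the profile is `C²`
across `0`; at `R` there is room because `R < S`. -/
theorem contDiffOn_radialGreen (hw : IsRegularWarp w S) (n : ℕ) {b : ℝ → ℝ}
    (hb : ContinuousOn b (Ico 0 S)) {R : ℝ} (hR : R ∈ Ico 0 S) :
    ContDiffOn ℝ 2 (radialGreen n w R b) (Icc 0 R) := by
  have h := hw.contDiffOn_radialGreen_norm n hb hR (E := ℝ)
  refine (h.mono fun r hr => ?_).congr fun r hr => ?_
  · rw [mem_ball_zero_iff, Real.norm_of_nonneg hr.1]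
    exact hr.2.trans_lt hR.2
  · rw [Real.norm_of_nonneg hr.1]

theorem continuousOn_warpRatio (hw : IsRegularWarp w S) : ContinuousOn (warpRatio w) (Ico 0 S) := by
  intro r hr
  rcases hr.1.eq_or_lt with h | h
  · subst h
    have h3 : ContinuousWithinAt (warpRatio w) (Ici 0) 0 := by
      rw [← continuousWithinAt_Ioi_iff_Ici, ContinuousWithinAt, warpRatio_zero]
      refine hw.tendsto_div_self.congr' (hw.eventually_mem_Ioo.mono fun r hr => ?_)
      exact (warpRatio_of_ne w hr.1.ne').symm
    exact h3.mono Ico_subset_Ici_self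
  · exact (hw.hasDerivAt_warpRatio ⟨h, hr.2⟩).continuousAt.continuousWithinAt

/-- The powers of `w` cancel, so this product can be differentiated without `w'`. -/
theorem warpRatio_pow_mul_radialSlope (hw : IsRegularWarp w S) (n : ℕ) (b : ℝ → ℝ) {r : ℝ}
    (hr : r ∈ Ioo 0 S) :
    warpRatio w r ^ n * radialSlope n w b r = radialMass n w b r / r ^ (n + 1) := by
  have := hr.1.ne'
  have := (hw.pos r hr).ne'
  rw [warpRatio_of_ne _ hr.1.ne', radialSlope_of_ne _ _ _ hr.1.ne', radialFlux, div_pow]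
  field_simp
  ring

theorem hasDerivAt_warpRatio_pow_mul_radialSlope (hw : IsRegularWarp w S) (n : ℕ) {b : ℝ → ℝ}
    (hb : ContinuousOn b (Ico 0 S)) {r : ℝ} (hr : r ∈ Ioo 0 S) :
    HasDerivAt (fun r => warpRatio w r ^ n * radialSlope n w b r)
      ((warpRatio w r ^ n * b r - (n + 1) * (warpRatio w r ^ n * radialSlope n w b r)) / r) r := by
  have hr0 := hr.1.ne'
  have h := (hw.hasDerivAt_radialMass n hb hr).div (hasDerivAt_pow (n + 1) r) (pow_ne_zero _ hr0)
  refine (h.congr_of_eventuallyEq ?_).congr_deriv ?_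
  · filter_upwards [isOpen_Ioo.mem_nhds hr] with s hs
    exact hw.warpRatio_pow_mul_radialSlope n b hs
  · rw [hw.warpRatio_pow_mul_radialSlope n b hr, warpRatio_of_ne _ hr0, div_pow]
    push_cast
    field_simp
    ring

/-- The Laplacian of the radial function with profile `radialGreen n w R b` is `-b`. -/
theorem laplaceBeltrami_radialGreen (hw : IsRegularWarp w S) (n : ℕ) {b : ℝ → ℝ}
    (hb : ContinuousOn b (Ico 0 S)) {R : ℝ} (hR : R ∈ Ico 0 S)
    {x : EuclideanSpace ℝ (Fin (n + 1))} (hx : ‖x‖ < S) :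
    laplaceBeltrami (modelMetric (n + 1) w) (fun y => radialGreen n w R b ‖y‖) x = -b ‖x‖ := by
  set k : ℝ → ℝ := fun r => -(warpRatio w r ^ n * radialSlope n w b r) with hk
  have hkc : ContinuousOn k (Ico 0 S) :=
    ((hw.continuousOn_warpRatio.pow n).mul (hw.continuousOn_radialSlope n hb)).neg
  have hkd := fun r (hr : r ∈ Ioo 0 S) =>
    (hw.hasDerivAt_warpRatio_pow_mul_radialSlope n hb hr).neg
  have hpos : ∀ y : EuclideanSpace ℝ (Fin (n + 1)), ‖y‖ < S → 0 < warpRatio w ‖y‖ := fun y hy =>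
    hw.warpRatio_pos ⟨norm_nonneg y, hy⟩
  -- The flux `√(det g) g⁻¹ ∇a` is the radial field `k(r) x`. Its divergence `(n+1) k + r k'` equals
  -- `-hⁿ b` with `h = w / r`, and `hⁿ` is the volume density.
  have hflux : ∀ i, (fun y => volumeDensity (modelMetric (n + 1) w) y * ∑ j,
      (modelMetric (n + 1) w y)⁻¹ i j * partialDeriv j (fun y => radialGreen n w R b ‖y‖) y)
      =ᶠ[𝓝 x] fun y => k ‖y‖ * y i := by
    intro i
    filter_upwards [(continuous_norm.tendsto x).eventually (gt_mem_nhds hx)] with y hy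
    have hd : ∀ j, partialDeriv j (fun y => radialGreen n w R b ‖y‖) y =
        -radialSlope n w b ‖y‖ * y j := fun j => by
      rw [partialDeriv, (hasFDerivAt_radial (hw.continuousOn_radialGreen n hb hR)
        (hw.continuousOn_radialSlope n hb)
        (fun _ hr => hw.hasDerivAt_radialGreen' n hb hR hr) hy).fderiv]
      simp [EuclideanSpace.inner_single_right]
    have hs : ∀ j, (modelMetric (n + 1) w y)⁻¹ i j * (-radialSlope n w b ‖y‖ * y j) =
        -radialSlope n w b ‖y‖ * ((modelMetric (n + 1) w y)⁻¹ i j * y j) := fun j => by ring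
    simp only [hd, hs]
    rw [← Finset.mul_sum, modelMetric_inv_mul_sum w (hpos y hy).ne',
      volumeDensity_modelMetric (by omega) w (hpos y hy), hk, Nat.add_sub_cancel]
    ring
  rw [laplaceBeltrami, Finset.sum_congr rfl fun i _ => (partialDeriv_congr (hflux i) i).eq_of_nhds,
    sum_partialDeriv_radialField hkc hkd hx,
    volumeDensity_modelMetric (by omega) w (hpos x hx), Nat.add_sub_cancel]
  have hne : warpRatio w ‖x‖ ^ n ≠ 0 := pow_ne_zero n (hpos x hx).ne'
  -- At the pole the term `r k'` drops out, and the slope's value `b(0)/(n+1)` alone produces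
  -- `-b(0)`.
  by_cases h0 : x = 0
  · simp only [h0, hk, norm_zero, radialSlope_zero, warpRatio_zero]
    push_cast
    field_simp
    ring
  · have : ‖x‖ ≠ 0 := norm_ne_zero_iff.2 h0
    simp only [hk]
    push_cast
    field_simp
    ring

end IsRegularWarp

/-! ### Order properties of the radial Green operator -/

/-- The quotient `f / g` is decreasing on `[0, R]`, in multiplied out form. -/
def CrossAntitone (R : ℝ) (f g : ℝ → ℝ) : Prop :=
  ∀ s t, 0 ≤ s → s ≤ t → t ≤ R → f t * g s ≤ f s * g t

/-- Integrate the pointwise inequality over the rectangle `[a, b] × [b, c]`. -/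
theorem integral_mul_integral_le {α β : ℝ → ℝ} {a b c : ℝ} (hab : a ≤ b) (hbc : b ≤ c)
    (hα₁ : IntervalIntegrable α volume a b) (hα₂ : IntervalIntegrable α volume b c)
    (hβ₁ : IntervalIntegrable β volume a b) (hβ₂ : IntervalIntegrable β volume b c)
    (h : ∀ σ ∈ Icc a b, ∀ τ ∈ Icc b c, α τ * β σ ≤ α σ * β τ) :
    (∫ τ in b..c, α τ) * (∫ σ in a..b, β σ) ≤ (∫ σ in a..b, α σ) * ∫ τ in b..c, β τ := by
  have h1 : ∀ σ ∈ Icc a b, (∫ τ in b..c, α τ) * β σ ≤ α σ * ∫ τ in b..c, β τ := fun σ hσ => by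
    rw [← intervalIntegral.integral_mul_const, ← intervalIntegral.integral_const_mul]
    exact intervalIntegral.integral_mono_on hbc (hα₂.mul_const _) (hβ₂.const_mul _) (h σ hσ)
  rw [← intervalIntegral.integral_const_mul, ← intervalIntegral.integral_mul_const]
  exact intervalIntegral.integral_mono_on hab (hβ₁.const_mul _) (hα₁.mul_const _) h1

theorem radialMass_const_mul (n : ℕ) (w b : ℝ → ℝ) (c r : ℝ) :
    radialMass n w (fun s => c * b s) r = c * radialMass n w b r := by
  simp only [radialMass, mul_left_comm _ c, intervalIntegral.integral_const_mul]

theorem radialFlux_const_mul (n : ℕ) (w b : ℝ → ℝ) (c r : ℝ) :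
    radialFlux n w (fun s => c * b s) r = c * radialFlux n w b r := by
  rw [radialFlux, radialMass_const_mul, mul_div_assoc, radialFlux]

theorem radialGreen_const_mul (n : ℕ) (w : ℝ → ℝ) (R : ℝ) (b : ℝ → ℝ) (c r : ℝ) :
    radialGreen n w R (fun s => c * b s) r = c * radialGreen n w R b r := by
  simp only [radialGreen, radialFlux_const_mul, intervalIntegral.integral_const_mul]

theorem radialGreen_sub (n : ℕ) {w : ℝ → ℝ} {R : ℝ} {b : ℝ → ℝ} {r s : ℝ}
    (h₁ : IntervalIntegrable (radialFlux n w b) volume r s)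
    (h₂ : IntervalIntegrable (radialFlux n w b) volume s R) :
    radialGreen n w R b r = (∫ t in r..s, radialFlux n w b t) + radialGreen n w R b s :=
  (intervalIntegral.integral_add_adjacent_intervals h₁ h₂).symm

namespace IsRegularWarp

variable {w : ℝ → ℝ} {S : ℝ}

theorem nonneg (hw : IsRegularWarp w S) {r : ℝ} (hr : r ∈ Ico 0 S) : 0 ≤ w r := by
  rcases hr.1.eq_or_lt with h | h
  · rw [← h, hw.zero]
  · exact (hw.pos r ⟨h, hr.2⟩).le

theorem pow_nonneg (hw : IsRegularWarp w S) (n : ℕ) {r : ℝ} (hr : r ∈ Ico 0 S) : 0 ≤ w r ^ n :=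
  _root_.pow_nonneg (hw.nonneg hr) n

theorem intervalIntegrable_radialFlux (hw : IsRegularWarp w S) (n : ℕ) {b : ℝ → ℝ}
    (hb : ContinuousOn b (Ico 0 S)) {r s : ℝ} (hr : r ∈ Ico 0 S) (hs : s ∈ Ico 0 S) :
    IntervalIntegrable (radialFlux n w b) volume r s :=
  intervalIntegrable_of_continuousOn_Ico (hw.continuousOn_radialFlux n hb) hr hs

theorem intervalIntegrable_pow_mul (hw : IsRegularWarp w S) (n : ℕ) {b : ℝ → ℝ}
    (hb : ContinuousOn b (Ico 0 S)) {r s : ℝ} (hr : r ∈ Ico 0 S) (hs : s ∈ Ico 0 S) :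
    IntervalIntegrable (fun s => w s ^ n * b s) volume r s :=
  intervalIntegrable_of_continuousOn_Ico (hw.continuousOn_pow_mul n hb) hr hs

variable {R : ℝ}

theorem mem_Ico_of_mem_Icc (hR : R ∈ Ioo 0 S) {r : ℝ} (hr : r ∈ Icc 0 R) : r ∈ Ico 0 S :=
  ⟨hr.1, hr.2.trans_lt hR.2⟩

theorem radialMass_mono (hw : IsRegularWarp w S) (hR : R ∈ Ioo 0 S) (n : ℕ) {f g : ℝ → ℝ}
    (hf : ContinuousOn f (Ico 0 S)) (hg : ContinuousOn g (Ico 0 S))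
    (hfg : ∀ r ∈ Icc 0 R, f r ≤ g r) {r : ℝ} (hr : r ∈ Icc 0 R) :
    radialMass n w f r ≤ radialMass n w g r := by
  have h0 : (0 : ℝ) ∈ Ico 0 S := ⟨le_rfl, hw.S_pos⟩
  have hr' := mem_Ico_of_mem_Icc hR hr
  refine intervalIntegral.integral_mono_on hr.1 (hw.intervalIntegrable_pow_mul n hf h0 hr')
    (hw.intervalIntegrable_pow_mul n hg h0 hr') fun s hs => ?_
  have hs' : s ∈ Icc 0 R := ⟨hs.1, hs.2.trans hr.2⟩
  exact mul_le_mul_of_nonneg_left (hfg s hs') (hw.pow_nonneg n (mem_Ico_of_mem_Icc hR hs'))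

theorem radialFlux_mono (hw : IsRegularWarp w S) (hR : R ∈ Ioo 0 S) (n : ℕ) {f g : ℝ → ℝ}
    (hf : ContinuousOn f (Ico 0 S)) (hg : ContinuousOn g (Ico 0 S))
    (hfg : ∀ r ∈ Icc 0 R, f r ≤ g r) {r : ℝ} (hr : r ∈ Icc 0 R) :
    radialFlux n w f r ≤ radialFlux n w g r :=
  div_le_div_of_nonneg_right (hw.radialMass_mono hR n hf hg hfg hr)
    (hw.pow_nonneg n (mem_Ico_of_mem_Icc hR hr))

theorem radialGreen_mono (hw : IsRegularWarp w S) (hR : R ∈ Ioo 0 S) (n : ℕ) {f g : ℝ → ℝ}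
    (hf : ContinuousOn f (Ico 0 S)) (hg : ContinuousOn g (Ico 0 S))
    (hfg : ∀ r ∈ Icc 0 R, f r ≤ g r) {r : ℝ} (hr : r ∈ Icc 0 R) :
    radialGreen n w R f r ≤ radialGreen n w R g r := by
  have hr' := mem_Ico_of_mem_Icc hR hr
  have hR' := Ioo_subset_Ico_self hR
  exact intervalIntegral.integral_mono_on hr.2 (hw.intervalIntegrable_radialFlux n hf hr' hR')
    (hw.intervalIntegrable_radialFlux n hg hr' hR') fun s hs =>
      hw.radialFlux_mono hR n hf hg hfg ⟨hr.1.trans hs.1, hs.2⟩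

theorem radialFlux_nonneg (hw : IsRegularWarp w S) (hR : R ∈ Ioo 0 S) (n : ℕ) {f : ℝ → ℝ}
    (hf : ∀ r ∈ Icc 0 R, 0 ≤ f r) {r : ℝ} (hr : r ∈ Icc 0 R) : 0 ≤ radialFlux n w f r := by
  refine div_nonneg (intervalIntegral.integral_nonneg hr.1 fun s hs => ?_)
    (hw.pow_nonneg n (mem_Ico_of_mem_Icc hR hr))
  have hs' : s ∈ Icc 0 R := ⟨hs.1, hs.2.trans hr.2⟩
  exact mul_nonneg (hw.pow_nonneg n (mem_Ico_of_mem_Icc hR hs')) (hf s hs')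

theorem radialFlux_pos (hw : IsRegularWarp w S) (hR : R ∈ Ioo 0 S) (n : ℕ) {f : ℝ → ℝ}
    (hf : ContinuousOn f (Ico 0 S)) (hpos : ∀ r ∈ Ico 0 R, 0 < f r) {r : ℝ} (hr : r ∈ Ioc 0 R) :
    0 < radialFlux n w f r := by
  have hr' : r ∈ Ioo 0 S := ⟨hr.1, hr.2.trans_lt hR.2⟩
  refine div_pos (intervalIntegral.intervalIntegral_pos_of_pos_on
    (hw.intervalIntegrable_pow_mul n hf ⟨le_rfl, hw.S_pos⟩ (Ioo_subset_Ico_self hr'))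
    (fun s hs => ?_) hr.1) (hw.pow_pos n hr')
  exact mul_pos (hw.pow_pos n ⟨hs.1, hs.2.trans hr'.2⟩) (hpos s ⟨hs.1.le, hs.2.trans_le hr.2⟩)

theorem radialGreen_pos (hw : IsRegularWarp w S) (hR : R ∈ Ioo 0 S) (n : ℕ) {f : ℝ → ℝ}
    (hf : ContinuousOn f (Ico 0 S)) (hpos : ∀ r ∈ Ico 0 R, 0 < f r) {r : ℝ} (hr : r ∈ Ico 0 R) :
    0 < radialGreen n w R f r :=
  intervalIntegral.intervalIntegral_pos_of_pos_on
    (hw.intervalIntegrable_radialFlux n hf (mem_Ico_of_mem_Icc hR (Ico_subset_Icc_self hr))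
      (Ioo_subset_Ico_self hR))
    (fun _ hs => hw.radialFlux_pos hR n hf hpos ⟨hr.1.trans_lt hs.1, hs.2.le⟩) hr.2

theorem radialGreen_antitone (hw : IsRegularWarp w S) (hR : R ∈ Ioo 0 S) (n : ℕ) {f : ℝ → ℝ}
    (hf : ContinuousOn f (Ico 0 S)) (hnn : ∀ r ∈ Icc 0 R, 0 ≤ f r) {s t : ℝ} (hs : 0 ≤ s)
    (hst : s ≤ t) (ht : t ≤ R) : radialGreen n w R f t ≤ radialGreen n w R f s := by
  have hs' := mem_Ico_of_mem_Icc hR ⟨hs, hst.trans ht⟩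
  have ht' := mem_Ico_of_mem_Icc hR ⟨hs.trans hst, ht⟩
  rw [radialGreen_sub n (hw.intervalIntegrable_radialFlux n hf hs' ht')
    (hw.intervalIntegrable_radialFlux n hf ht' (Ioo_subset_Ico_self hR))]
  refine le_add_of_nonneg_left (intervalIntegral.integral_nonneg hst fun r hr => ?_)
  exact hw.radialFlux_nonneg hR n hnn ⟨hs.trans hr.1, hr.2.trans ht⟩

/-- The factor `w⁻ⁿ` is common to both fluxes, so the masses may be compared. Splitting `∫₀ᵗ = ∫₀ˢ +
∫ₛᵗ`, the products over `[0, s]` cancel and the mixed ones are compared by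
`integral_mul_integral_le`. -/
theorem crossAntitone_radialFlux (hw : IsRegularWarp w S) (hR : R ∈ Ioo 0 S) (n : ℕ)
    {f g : ℝ → ℝ} (hf : ContinuousOn f (Ico 0 S)) (hg : ContinuousOn g (Ico 0 S))
    (hfg : CrossAntitone R f g) : CrossAntitone R (radialFlux n w f) (radialFlux n w g) := by
  intro s t hs hst ht
  have h0 : (0 : ℝ) ∈ Ico 0 S := ⟨le_rfl, hw.S_pos⟩
  have hs' := mem_Ico_of_mem_Icc hR ⟨hs, hst.trans ht⟩
  have ht' := mem_Ico_of_mem_Icc hR ⟨hs.trans hst, ht⟩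
  have key := integral_mul_integral_le hs hst (hw.intervalIntegrable_pow_mul n hf h0 hs')
    (hw.intervalIntegrable_pow_mul n hf hs' ht') (hw.intervalIntegrable_pow_mul n hg h0 hs')
    (hw.intervalIntegrable_pow_mul n hg hs' ht') fun σ hσ τ hτ => by
      have h1 := hw.pow_nonneg n (mem_Ico_of_mem_Icc hR ⟨hσ.1, (hσ.2.trans hst).trans ht⟩)
      have h2 := hw.pow_nonneg n (mem_Ico_of_mem_Icc hR ⟨hs.trans hτ.1, hτ.2.trans ht⟩)
      have h3 := mul_le_mul_of_nonneg_left
        (hfg σ τ hσ.1 (hσ.2.trans hτ.1) (hτ.2.trans ht)) (mul_nonneg h1 h2)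
      linarith
  have hsplit : ∀ {b : ℝ → ℝ}, ContinuousOn b (Ico 0 S) →
      radialMass n w b t = radialMass n w b s + ∫ r in s..t, w r ^ n * b r := fun hb =>
    (intervalIntegral.integral_add_adjacent_intervals (hw.intervalIntegrable_pow_mul n hb h0 hs')
      (hw.intervalIntegrable_pow_mul n hb hs' ht')).symm
  have hmass : radialMass n w f t * radialMass n w g s ≤
      radialMass n w f s * radialMass n w g t := by
    rw [hsplit hf, hsplit hg, add_mul, mul_add]
    exact add_le_add_right key _
  rw [radialFlux, radialFlux, radialFlux, radialFlux, div_mul_div_comm, div_mul_div_comm,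
    mul_comm (w s ^ n)]
  exact div_le_div_of_nonneg_right hmass (mul_nonneg (hw.pow_nonneg n ht') (hw.pow_nonneg n hs'))

/-- The same splitting argument from the outer end, `∫ₛᴿ = ∫ₛᵗ + ∫ₜᴿ`, applied to the fluxes. The
multiplied-out form of the relation avoids dividing by zero at `R`. -/
theorem crossAntitone_radialGreen (hw : IsRegularWarp w S) (hR : R ∈ Ioo 0 S) (n : ℕ)
    {f g : ℝ → ℝ} (hf : ContinuousOn f (Ico 0 S)) (hg : ContinuousOn g (Ico 0 S))
    (hfg : CrossAntitone R f g) :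
    CrossAntitone R (radialGreen n w R f) (radialGreen n w R g) := by
  intro s t hs hst ht
  have hs' := mem_Ico_of_mem_Icc hR ⟨hs, hst.trans ht⟩
  have ht' := mem_Ico_of_mem_Icc hR ⟨hs.trans hst, ht⟩
  have hR' := Ioo_subset_Ico_self hR
  have hfl := hw.crossAntitone_radialFlux hR n hf hg hfg
  have key := integral_mul_integral_le hst ht (hw.intervalIntegrable_radialFlux n hf hs' ht')
    (hw.intervalIntegrable_radialFlux n hf ht' hR') (hw.intervalIntegrable_radialFlux n hg hs' ht')
    (hw.intervalIntegrable_radialFlux n hg ht' hR') fun σ hσ τ hτ =>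
      hfl σ τ (hs.trans hσ.1) (hσ.2.trans hτ.1) hτ.2
  rw [radialGreen_sub n (hw.intervalIntegrable_radialFlux n hf hs' ht')
    (hw.intervalIntegrable_radialFlux n hf ht' hR'),
    radialGreen_sub n (hw.intervalIntegrable_radialFlux n hg hs' ht')
    (hw.intervalIntegrable_radialFlux n hg ht' hR'), mul_add, add_mul]
  exact add_le_add_left key _

end IsRegularWarp

/-! ### Iterates of the radial Green operator -/

/-- The iterates of the radial Green operator on the constant function `1`. -/
def greenIter (n : ℕ) (w : ℝ → ℝ) (R : ℝ) : ℕ → ℝ → ℝ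
  | 0 => fun _ => 1
  | k + 1 => radialGreen n w R (greenIter n w R k)

namespace IsRegularWarp

variable {w : ℝ → ℝ} {S R : ℝ}

theorem continuousOn_greenIter (hw : IsRegularWarp w S) (hR : R ∈ Ioo 0 S) (n k : ℕ) :
    ContinuousOn (greenIter n w R k) (Ico 0 S) := by
  induction k with
  | zero => exact continuousOn_const
  | succ k ih => exact hw.continuousOn_radialGreen n ih (Ioo_subset_Ico_self hR)

theorem greenIter_pos (hw : IsRegularWarp w S) (hR : R ∈ Ioo 0 S) (n k : ℕ) :
    ∀ r ∈ Ico 0 R, 0 < greenIter n w R k r := by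
  induction k with
  | zero => exact fun _ _ => one_pos
  | succ k ih => exact fun r hr => hw.radialGreen_pos hR n (hw.continuousOn_greenIter hR n k) ih hr

theorem greenIter_zero_pos (hw : IsRegularWarp w S) (hR : R ∈ Ioo 0 S) (n k : ℕ) :
    0 < greenIter n w R k 0 := hw.greenIter_pos hR n k 0 ⟨le_rfl, hR.1⟩

theorem greenIter_nonneg (hw : IsRegularWarp w S) (hR : R ∈ Ioo 0 S) (n k : ℕ) :
    ∀ r ∈ Icc 0 R, 0 ≤ greenIter n w R k r := by
  intro r hr
  rcases hr.2.eq_or_lt with h | h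
  · rw [h]
    cases k with
    | zero => exact zero_le_one
    | succ k => exact (radialGreen_self n w R _).ge
  · exact (hw.greenIter_pos hR n k r ⟨hr.1, h⟩).le

theorem greenIter_antitone (hw : IsRegularWarp w S) (hR : R ∈ Ioo 0 S) (n k : ℕ) {s t : ℝ}
    (hs : 0 ≤ s) (hst : s ≤ t) (ht : t ≤ R) : greenIter n w R k t ≤ greenIter n w R k s := by
  cases k with
  | zero => exact le_rfl
  | succ k =>
    exact hw.radialGreen_antitone hR n (hw.continuousOn_greenIter hR n k)
      (hw.greenIter_nonneg hR n k) hs hst ht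

/-- For `k = 0` this is the monotonicity of `T1`; the Green operator then carries the relation from
each pair of iterates to the next. -/
theorem crossAntitone_greenIter (hw : IsRegularWarp w S) (hR : R ∈ Ioo 0 S) (n k : ℕ) :
    CrossAntitone R (greenIter n w R (k + 1)) (greenIter n w R k) := by
  induction k with
  | zero =>
    intro s t hs hst ht
    simpa [greenIter] using hw.greenIter_antitone hR n 1 hs hst ht
  | succ k ih =>
    exact hw.crossAntitone_radialGreen hR n (hw.continuousOn_greenIter hR n (k + 1))
      (hw.continuousOn_greenIter hR n k) ih

end IsRegularWarp

/-- The quotients `a_{k+1}(0) / a_k(0)` of the iterates `a_k` at the pole. -/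
def greenRatio (n : ℕ) (w : ℝ → ℝ) (R : ℝ) (k : ℕ) : ℝ :=
  greenIter n w R (k + 1) 0 / greenIter n w R k 0

/-- The iterates, normalized to be `1` at the pole. -/
def greenNormalized (n : ℕ) (w : ℝ → ℝ) (R : ℝ) (k : ℕ) (r : ℝ) : ℝ :=
  greenIter n w R k r / greenIter n w R k 0

namespace IsRegularWarp

variable {w : ℝ → ℝ} {S R : ℝ}

theorem greenRatio_pos (hw : IsRegularWarp w S) (hR : R ∈ Ioo 0 S) (n k : ℕ) :
    0 < greenRatio n w R k :=
  div_pos (hw.greenIter_zero_pos hR n _) (hw.greenIter_zero_pos hR n _)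

/-- A decreasing quotient is largest at the pole. -/
theorem greenIter_succ_le (hw : IsRegularWarp w S) (hR : R ∈ Ioo 0 S) (n k : ℕ) {r : ℝ}
    (hr : r ∈ Icc 0 R) :
    greenIter n w R (k + 1) r ≤ greenRatio n w R k * greenIter n w R k r := by
  have h := hw.crossAntitone_greenIter hR n k 0 r le_rfl hr.1 hr.2
  rw [greenRatio, div_mul_eq_mul_div, le_div_iff₀ (hw.greenIter_zero_pos hR n k)]
  exact h

/-- Apply the monotone operator `T` to `a_{k+1} ≤ ρ_k a_k` and evaluate at the pole. -/
theorem greenRatio_antitone (hw : IsRegularWarp w S) (hR : R ∈ Ioo 0 S) (n : ℕ) :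
    Antitone (greenRatio n w R) := by
  refine antitone_nat_of_succ_le fun k => ?_
  have h := hw.radialGreen_mono hR n (hw.continuousOn_greenIter hR n (k + 1))
    (continuousOn_const.fun_mul (hw.continuousOn_greenIter hR n k))
    (fun r hr => hw.greenIter_succ_le hR n k hr) (left_mem_Icc.2 hR.1.le)
  rw [radialGreen_const_mul] at h
  rw [greenRatio, div_le_iff₀ (hw.greenIter_zero_pos hR n _)]
  exact h

/-- As `a_k` is decreasing, it is at least `a_k(ρ)` on `[0, ρ]`. The mass collected there flows
through the whole annulus `[ρ, R]`, which gives `a_{k+1}(ρ) ≥ c a_k(ρ)` with `c` independent of `k`;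
compare with `a_{k+1}(ρ) ≤ ρ_k a_k(ρ)`, where `ρ_k` is the ratio at the pole. -/
theorem exists_le_greenRatio (hw : IsRegularWarp w S) (hR : R ∈ Ioo 0 S) (n : ℕ) :
    ∃ c > 0, ∀ k, c ≤ greenRatio n w R k := by
  have hr0 : R / 2 ∈ Ioo 0 R := ⟨half_pos hR.1, half_lt_self hR.1⟩
  -- Any radius strictly between `0` and `R` would serve.
  set ρ := R / 2 with hρ
  have h0 : (0 : ℝ) ∈ Ico 0 S := ⟨le_rfl, hw.S_pos⟩
  have hρS : ρ ∈ Ico 0 S := mem_Ico_of_mem_Icc hR ⟨hr0.1.le, hr0.2.le⟩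
  have hone : ContinuousOn (fun _ : ℝ => (1 : ℝ)) (Ico 0 S) := continuousOn_const
  have hmass : 0 < radialMass n w (fun _ => 1) ρ :=
    intervalIntegral.intervalIntegral_pos_of_pos_on
      (hw.intervalIntegrable_pow_mul n hone h0 hρS)
      (fun s hs => mul_pos (hw.pow_pos n ⟨hs.1, hs.2.trans hρS.2⟩) one_pos) hr0.1
  have hinvc : ContinuousOn (fun s => (w s ^ n)⁻¹) (Icc ρ R) :=
    ((hw.continuousOn.pow n).mono fun s hs => ⟨hr0.1.le.trans hs.1, hs.2.trans_lt hR.2⟩).inv₀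
      fun s hs => (hw.pow_pos n ⟨hr0.1.trans_le hs.1, hs.2.trans_lt hR.2⟩).ne'
  have hinvi : IntervalIntegrable (fun s => (w s ^ n)⁻¹) volume ρ R :=
    hinvc.intervalIntegrable_of_Icc hr0.2.le
  have hinv : 0 < ∫ s in ρ..R, (w s ^ n)⁻¹ :=
    intervalIntegral.intervalIntegral_pos_of_pos_on hinvi
      (fun s hs => inv_pos.2 (hw.pow_pos n ⟨hr0.1.trans hs.1, hs.2.trans hR.2⟩)) hr0.2
  refine ⟨radialMass n w (fun _ => 1) ρ * ∫ s in ρ..R, (w s ^ n)⁻¹, mul_pos hmass hinv,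
    fun k => ?_⟩
  have hpos : 0 < greenIter n w R k ρ := hw.greenIter_pos hR n k ρ ⟨hr0.1.le, hr0.2⟩
  have hak := hw.continuousOn_greenIter hR n k
  have hm : ∀ s ∈ Icc ρ R, greenIter n w R k ρ * radialMass n w (fun _ => 1) ρ ≤
      radialMass n w (greenIter n w R k) s := by
    intro s hs
    have hsS : s ∈ Ico 0 S := ⟨hr0.1.le.trans hs.1, hs.2.trans_lt hR.2⟩
    have h1 : greenIter n w R k ρ * radialMass n w (fun _ => 1) ρ ≤
        radialMass n w (greenIter n w R k) ρ := by
      rw [← radialMass_const_mul]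
      have hρ' : ρ ∈ Ioo 0 S := ⟨hr0.1, hρS.2⟩
      refine hw.radialMass_mono hρ' n (continuousOn_const.fun_mul hone) hak (fun r hr => ?_)
        ⟨hr0.1.le, le_rfl⟩
      rw [mul_one]
      exact hw.greenIter_antitone hR n k hr.1 hr.2 hr0.2.le
    refine h1.trans ?_
    rw [radialMass, radialMass, ← intervalIntegral.integral_add_adjacent_intervals
      (hw.intervalIntegrable_pow_mul n hak h0 hρS) (hw.intervalIntegrable_pow_mul n hak hρS hsS)]
    refine le_add_of_nonneg_right (intervalIntegral.integral_nonneg hs.1 fun t ht => ?_)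
    have ht' : t ∈ Icc 0 R := ⟨hr0.1.le.trans ht.1, ht.2.trans hs.2⟩
    exact mul_nonneg (hw.pow_nonneg n (mem_Ico_of_mem_Icc hR ht')) (hw.greenIter_nonneg hR n k t ht')
  have hstep : greenIter n w R k ρ * (radialMass n w (fun _ => 1) ρ * ∫ s in ρ..R, (w s ^ n)⁻¹) ≤
      greenIter n w R (k + 1) ρ := by
    rw [← mul_assoc, ← intervalIntegral.integral_const_mul]
    refine intervalIntegral.integral_mono_on hr0.2.le (hinvi.const_mul _)
      (hw.intervalIntegrable_radialFlux n hak hρS (Ioo_subset_Ico_self hR)) fun s hs => ?_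
    rw [radialFlux, div_eq_mul_inv]
    exact mul_le_mul_of_nonneg_right (hm s hs) (inv_nonneg.2
      (hw.pow_nonneg n ⟨hr0.1.le.trans hs.1, hs.2.trans_lt hR.2⟩))
  have h2 := hstep.trans (hw.greenIter_succ_le hR n k ⟨hr0.1.le, hr0.2.le⟩)
  rw [mul_comm (greenRatio n w R k)] at h2
  exact le_of_mul_le_mul_left h2 hpos

end IsRegularWarp

/-! ### The limit of the normalized iterates -/

namespace IsRegularWarp

variable {w : ℝ → ℝ} {S R : ℝ}

theorem continuousOn_greenNormalized (hw : IsRegularWarp w S) (hR : R ∈ Ioo 0 S) (n k : ℕ) :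
    ContinuousOn (greenNormalized n w R k) (Ico 0 S) :=
  (hw.continuousOn_greenIter hR n k).div_const _

theorem greenNormalized_zero (hw : IsRegularWarp w S) (hR : R ∈ Ioo 0 S) (n k : ℕ) :
    greenNormalized n w R k 0 = 1 :=
  div_self (hw.greenIter_zero_pos hR n k).ne'

theorem greenNormalized_nonneg (hw : IsRegularWarp w S) (hR : R ∈ Ioo 0 S) (n k : ℕ) {r : ℝ}
    (hr : r ∈ Icc 0 R) : 0 ≤ greenNormalized n w R k r :=
  div_nonneg (hw.greenIter_nonneg hR n k r hr) (hw.greenIter_zero_pos hR n k).le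

theorem greenNormalized_le_one (hw : IsRegularWarp w S) (hR : R ∈ Ioo 0 S) (n k : ℕ) {r : ℝ}
    (hr : r ∈ Icc 0 R) : greenNormalized n w R k r ≤ 1 :=
  div_le_one_of_le₀ (hw.greenIter_antitone hR n k le_rfl hr.1 hr.2)
    (hw.greenIter_zero_pos hR n k).le

/-- This is `CrossAntitone` for consecutive iterates, read at the pair `0 ≤ r`. -/
theorem greenNormalized_antitone (hw : IsRegularWarp w S) (hR : R ∈ Ioo 0 S) (n : ℕ) {r : ℝ}
    (hr : r ∈ Icc 0 R) : Antitone fun k => greenNormalized n w R k r := by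
  refine antitone_nat_of_succ_le fun k => ?_
  have h := hw.crossAntitone_greenIter hR n k 0 r le_rfl hr.1 hr.2
  rw [greenNormalized, greenNormalized, div_le_div_iff₀ (hw.greenIter_zero_pos hR n _)
    (hw.greenIter_zero_pos hR n _)]
  linarith

theorem radialGreen_greenNormalized (hw : IsRegularWarp w S) (hR : R ∈ Ioo 0 S) (n k : ℕ) (r : ℝ) :
    radialGreen n w R (greenNormalized n w R k) r =
      greenRatio n w R k * greenNormalized n w R (k + 1) r := by
  have h : greenNormalized n w R k = fun s => (greenIter n w R k 0)⁻¹ * greenIter n w R k s := by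
    ext s
    rw [greenNormalized, div_eq_inv_mul]
  have h1 := (hw.greenIter_zero_pos hR n k).ne'
  have h2 := (hw.greenIter_zero_pos hR n (k + 1)).ne'
  rw [h, radialGreen_const_mul, greenRatio, greenNormalized, greenIter]
  rw [greenIter] at h2
  field_simp

/-- The normalized iterates converge to a fixed point of the Green operator up to a factor. -/
theorem exists_tendsto_greenNormalized (hw : IsRegularWarp w S) (hR : R ∈ Ioo 0 S) (n : ℕ) :
    ∃ μ > 0, ∃ G : ℝ → ℝ, Continuous G ∧ Tendsto (greenRatio n w R) atTop (𝓝 μ) ∧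
      (∀ r ∈ Icc 0 R, Tendsto (fun k => greenNormalized n w R k r) atTop (𝓝 (G r))) ∧
      ∀ r ∈ Icc 0 R, radialGreen n w R G r = μ * G r := by
  obtain ⟨c, hc, hcle⟩ := hw.exists_le_greenRatio hR n
  have hbdd : BddBelow (range (greenRatio n w R)) := ⟨c, by rintro _ ⟨k, rfl⟩; exact hcle k⟩
  have hμ := tendsto_atTop_ciInf (hw.greenRatio_antitone hR n) hbdd
  set μ := ⨅ k, greenRatio n w R k
  have hμpos : 0 < μ := hc.trans_le (le_ciInf hcle)
  have hRS := Ioo_subset_Ico_self hR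
  have hone : ContinuousOn (fun _ : ℝ => (1 : ℝ)) (Ico 0 S) := continuousOn_const
  have hg := hw.continuousOn_greenNormalized hR n
  obtain ⟨g, hglim⟩ : ∃ g : ℝ → ℝ, ∀ r ∈ Icc 0 R,
      Tendsto (fun k => greenNormalized n w R k r) atTop (𝓝 (g r)) :=
    ⟨fun r => ⨅ k, greenNormalized n w R k r, fun r hr => tendsto_atTop_ciInf
      (hw.greenNormalized_antitone hR n hr)
      ⟨0, by rintro _ ⟨k, rfl⟩; exact hw.greenNormalized_nonneg hR n k hr⟩⟩
  have hfluxle : ∀ k, ∀ r ∈ Icc 0 R, |radialFlux n w (greenNormalized n w R k) r| ≤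
      radialFlux n w (fun _ => 1) r := fun k r hr => by
    rw [abs_of_nonneg (hw.radialFlux_nonneg hR n
      (fun r hr => hw.greenNormalized_nonneg hR n k hr) hr)]
    exact hw.radialFlux_mono hR n (hg k) hone (fun r hr => hw.greenNormalized_le_one hR n k hr) hr
  obtain ⟨C, hC⟩ : ∃ C, ∀ r ∈ Icc 0 R, radialFlux n w (fun _ => 1) r ≤ C := by
    obtain ⟨C, hC⟩ := isCompact_Icc.bddAbove_image ((hw.continuousOn_radialFlux n hone).mono
      fun r (hr : r ∈ Icc 0 R) => mem_Ico_of_mem_Icc hR hr)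
    exact ⟨C, fun r hr => hC (mem_image_of_mem _ hr)⟩
  -- From `ρ_k g_{k+1} = T g_k` the slope of `g_{k+1}` is a flux, at most `C`, divided by `ρ_k ≥ c`.
  -- The constant is uniform in `k`, so the limit inherits it and is continuous.
  have hlip : ∀ k, ∀ r ∈ Icc 0 R, ∀ s ∈ Icc 0 R,
      |greenNormalized n w R (k + 1) r - greenNormalized n w R (k + 1) s| ≤ C / c * |r - s| := by
    intro k r hr s hs
    have hr' := mem_Ico_of_mem_Icc hR hr
    have hs' := mem_Ico_of_mem_Icc hR hs
    have h1 : greenRatio n w R k *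
        (greenNormalized n w R (k + 1) r - greenNormalized n w R (k + 1) s) =
        ∫ t in r..s, radialFlux n w (greenNormalized n w R k) t := by
      rw [mul_sub, ← hw.radialGreen_greenNormalized hR, ← hw.radialGreen_greenNormalized hR,
        radialGreen_sub n (hw.intervalIntegrable_radialFlux n (hg k) hr' hs')
        (hw.intervalIntegrable_radialFlux n (hg k) hs' hRS), add_sub_cancel_right]
    have h2 := intervalIntegral.norm_integral_le_of_norm_le_const (a := r) (b := s)
      (f := radialFlux n w (greenNormalized n w R k)) (C := C) fun t ht => by
        have ht' : t ∈ Icc 0 R := ordConnected_Icc.uIcc_subset hr hs (uIoc_subset_uIcc ht)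
        exact (hfluxle k t ht').trans (hC t ht')
    rw [← h1, Real.norm_eq_abs, abs_mul, abs_of_pos (hw.greenRatio_pos hR n k), abs_sub_comm s] at h2
    rw [div_mul_eq_mul_div, le_div_iff₀ hc, mul_comm]
    exact (mul_le_mul_of_nonneg_right (hcle k) (abs_nonneg _)).trans h2
  have hgc : ContinuousOn g (Icc 0 R) := by
    have hL : ∀ r ∈ Icc 0 R, ∀ s ∈ Icc 0 R, |g r - g s| ≤ C / c * |r - s| := fun r hr s hs =>
      le_of_tendsto (((hglim r hr).sub (hglim s hs)).abs.comp (tendsto_add_atTop_nat 1))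
        (Eventually.of_forall fun k => hlip k r hr s hs)
    have hCnn : 0 ≤ C / c := div_nonneg
      ((abs_nonneg _).trans ((hfluxle 0 0 (left_mem_Icc.2 hR.1.le)).trans
        (hC 0 (left_mem_Icc.2 hR.1.le)))) hc.le
    exact (LipschitzOnWith.of_dist_le_mul (K := ⟨C / c, hCnn⟩) fun r hr s hs => hL r hr s hs).continuousOn
  -- Extension by constants beyond `[0, R]`, because the lemmas on `T` ask for continuity on `[0,
  -- S)`; only values on `[0, R]` enter `T G` there.
  set G : ℝ → ℝ := fun r => g (projIcc 0 R hR.1.le r) with hG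
  have hGg : ∀ r ∈ Icc 0 R, G r = g r := fun r hr => by rw [hG]; simp [projIcc_of_mem hR.1.le hr]
  have hGc : Continuous G := hgc.comp_continuous (continuous_subtype_val.comp continuous_projIcc)
    fun r => (projIcc 0 R hR.1.le r).2
  have hGlim : ∀ r ∈ Icc 0 R, Tendsto (fun k => greenNormalized n w R k r) atTop (𝓝 (G r)) :=
    fun r hr => by rw [hGg r hr]; exact hglim r hr
  have h0S : (0 : ℝ) ∈ Ico 0 S := ⟨le_rfl, hw.S_pos⟩
  have hfluxlim : ∀ r ∈ Icc 0 R, Tendsto (fun k => radialFlux n w (greenNormalized n w R k) r)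
      atTop (𝓝 (radialFlux n w G r)) := by
    intro r hr
    have hr' := mem_Ico_of_mem_Icc hR hr
    refine Tendsto.div_const (intervalIntegral.tendsto_integral_filter_of_dominated_convergence
      (fun s => w s ^ n * 1) (Eventually.of_forall fun k =>
        (hw.intervalIntegrable_pow_mul n (hg k) h0S hr').aestronglyMeasurable_restrict_uIoc)
      (Eventually.of_forall fun k => Eventually.of_forall fun s hs => ?_)
      (hw.intervalIntegrable_pow_mul n hone h0S hr')
      (Eventually.of_forall fun s hs => ?_)) _
    all_goals
      rw [uIoc_of_le hr.1] at hs
      have hs' : s ∈ Icc 0 R := ⟨hs.1.le, hs.2.trans hr.2⟩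
    · have h1 := hw.pow_nonneg n (mem_Ico_of_mem_Icc hR hs')
      have h2 := hw.greenNormalized_nonneg hR n k hs'
      rw [Real.norm_of_nonneg (mul_nonneg h1 h2)]
      exact mul_le_mul_of_nonneg_left (hw.greenNormalized_le_one hR n k hs') h1
    · exact (hGlim s hs').const_mul _
  have hgreenlim : ∀ r ∈ Icc 0 R, Tendsto (fun k => radialGreen n w R (greenNormalized n w R k) r)
      atTop (𝓝 (radialGreen n w R G r)) := by
    intro r hr
    have hr' := mem_Ico_of_mem_Icc hR hr
    refine intervalIntegral.tendsto_integral_filter_of_dominated_convergence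
      (radialFlux n w fun _ => 1) (Eventually.of_forall fun k =>
        (hw.intervalIntegrable_radialFlux n (hg k) hr' hRS).aestronglyMeasurable_restrict_uIoc)
      (Eventually.of_forall fun k => Eventually.of_forall fun s hs => ?_)
      (hw.intervalIntegrable_radialFlux n hone hr' hRS)
      (Eventually.of_forall fun s hs => ?_)
    all_goals
      rw [uIoc_of_le hr.2] at hs
      have hs' : s ∈ Icc 0 R := ⟨hr.1.trans hs.1.le, hs.2⟩
    · exact hfluxle k s hs'
    · exact hfluxlim s hs'
  -- Both sides of `T g_k = ρ_k g_{k+1}` converge, and limits are unique.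
  refine ⟨μ, hμpos, G, hGc, hμ, hGlim, fun r hr => tendsto_nhds_unique (hgreenlim r hr) ?_⟩
  simp only [hw.radialGreen_greenNormalized hR]
  exact hμ.mul ((hGlim r hr).comp (tendsto_add_atTop_nat 1))

end IsRegularWarp

/-! ### The maximum principle on geodesic balls -/

namespace IsRegularWarp

variable {w : ℝ → ℝ} {S R : ℝ}

theorem norm_mem_Icc {E : Type*} [NormedAddCommGroup E] {x : E} (hx : x ∈ Metric.closedBall 0 R) :
    ‖x‖ ∈ Icc 0 R := ⟨norm_nonneg x, mem_closedBall_zero_iff.1 hx⟩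

theorem continuousOn_comp_norm {E : Type*} [NormedAddCommGroup E] (hR : R ∈ Ioo 0 S) {f : ℝ → ℝ}
    (hf : ContinuousOn f (Ico 0 S)) :
    ContinuousOn (fun x : E => f ‖x‖) (Metric.closedBall 0 R) :=
  hf.comp continuous_norm.continuousOn fun _ hx => mem_Ico_of_mem_Icc hR (norm_mem_Icc hx)

theorem contDiffAt_radialGreen_norm (hw : IsRegularWarp w S) (hR : R ∈ Ioo 0 S) (n : ℕ)
    {b : ℝ → ℝ} (hb : ContinuousOn b (Ico 0 S)) {E : Type*} [NormedAddCommGroup E]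
    [InnerProductSpace ℝ E] [FiniteDimensional ℝ E] {x : E} (hx : x ∈ Metric.ball 0 R) :
    ContDiffAt ℝ 2 (fun y : E => radialGreen n w R b ‖y‖) x :=
  (hw.contDiffOn_radialGreen_norm n hb (Ioo_subset_Ico_self hR)).contDiffAt
    (Metric.isOpen_ball.mem_nhds (Metric.ball_subset_ball hR.2.le hx))

theorem differentiableAt_coeff_of_mem_ball (hw : IsRegularWarp w S) (hR : R ∈ Ioo 0 S) (n : ℕ)
    {x : EuclideanSpace ℝ (Fin (n + 1))} (hx : x ∈ Metric.ball 0 R) (i j : Fin (n + 1)) :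
    DifferentiableAt ℝ (fun y => volumeDensity (modelMetric (n + 1) w) y *
      (modelMetric (n + 1) w y)⁻¹ i j) x :=
  hw.differentiableAt_coeff (by omega) ((mem_ball_zero_iff.1 hx).trans hR.2) i j

/-- The weak maximum principle for `Δ + c` with `c ≤ 0`. -/
theorem nonneg_of_laplaceBeltrami_add_nonpos (hw : IsRegularWarp w S) (hR : R ∈ Ioo 0 S) {n : ℕ}
    {c : ℝ} (hc : c ≤ 0) {u : EuclideanSpace ℝ (Fin (n + 1)) → ℝ}
    (hu : ContDiffOn ℝ 2 u (Metric.ball 0 R)) (huc : ContinuousOn u (Metric.closedBall 0 R))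
    (hΔ : ∀ x ∈ Metric.ball 0 R, laplaceBeltrami (modelMetric (n + 1) w) u x + c * u x ≤ 0)
    (hb : ∀ x ∈ Metric.sphere 0 R, 0 ≤ u x) : ∀ x ∈ Metric.closedBall 0 R, 0 ≤ u x := by
  set a := greenIter n w R 1 with ha
  have hone : ContinuousOn (fun _ : ℝ => (1 : ℝ)) (Ico 0 S) := continuousOn_const
  have hac := hw.continuousOn_greenIter hR n 1
  have hann : ∀ x ∈ Metric.closedBall (0 : EuclideanSpace ℝ (Fin (n + 1))) R, 0 ≤ a ‖x‖ :=
    fun x hx => hw.greenIter_nonneg hR n 1 _ (norm_mem_Icc hx)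
  -- Adding `ε T1`, with Laplacian `-ε`, turns the weak inequality into a strict one at an interior
  -- negative minimum. The factor `1` matches the shape of `laplaceBeltrami_lincomb`.
  have key : ∀ ε > 0, ∀ x ∈ Metric.closedBall (0 : EuclideanSpace ℝ (Fin (n + 1))) R,
      0 ≤ 1 * u x + ε * a ‖x‖ := by
    intro ε hε
    have hzc : ContinuousOn (fun x => 1 * u x + ε * a ‖x‖) (Metric.closedBall 0 R) :=
      (continuousOn_const.mul huc).add (continuousOn_const.mul (continuousOn_comp_norm hR hac))
    obtain ⟨x₀, hx₀, hmin⟩ := (isCompact_closedBall (0 : EuclideanSpace ℝ (Fin (n + 1)))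
      R).exists_isMinOn ⟨0, Metric.mem_closedBall_self hR.1.le⟩ hzc
    suffices h : 0 ≤ 1 * u x₀ + ε * a ‖x₀‖ from fun x hx => h.trans (hmin hx)
    by_contra! hneg
    have hball : x₀ ∈ Metric.ball (0 : EuclideanSpace ℝ (Fin (n + 1))) R := by
      rcases (mem_closedBall_zero_iff.1 hx₀).lt_or_eq with h | h
      · exact mem_ball_zero_iff.2 h
      · have := hb x₀ (mem_sphere_zero_iff_norm.2 h)
        have := mul_nonneg hε.le (hann x₀ hx₀)
        linarith
    have hcoeff := hw.differentiableAt_coeff_of_mem_ball hR n hball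
    have hu₀ : ContDiffAt ℝ 2 u x₀ := hu.contDiffAt (Metric.isOpen_ball.mem_nhds hball)
    have ha₀ : ContDiffAt ℝ 2 (fun y : EuclideanSpace ℝ (Fin (n + 1)) => a ‖y‖) x₀ :=
      hw.contDiffAt_radialGreen_norm hR n hone hball
    have hloc : IsLocalMin (fun x => 1 * u x + ε * a ‖x‖) x₀ :=
      hmin.isLocalMin (mem_of_superset (Metric.isOpen_ball.mem_nhds hball)
        Metric.ball_subset_closedBall)
    have h1 := laplaceBeltrami_nonneg_of_isLocalMin hcoeff (modelMetric_posSemidef w x₀)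
      ((contDiffAt_const.mul hu₀).add (contDiffAt_const.mul ha₀)) hloc
    rw [laplaceBeltrami_lincomb hcoeff hu₀ ha₀] at h1
    have h2 : laplaceBeltrami (modelMetric (n + 1) w) (fun y => a ‖y‖) x₀ = -1 :=
      hw.laplaceBeltrami_radialGreen n hone (Ioo_subset_Ico_self hR)
        ((mem_ball_zero_iff.1 hball).trans hR.2)
    have h3 := hΔ x₀ hball
    -- With `h5` this gives `c u(x₀) ≥ 0`, so `Δu ≤ 0` and the perturbed function has Laplacian at
    -- most `-ε`, against `h1`.
    have h4 := mul_nonneg_of_nonpos_of_nonpos hc hneg.le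
    have h5 := mul_nonneg hε.le (mul_nonneg (neg_nonneg.2 hc) (hann x₀ hx₀))
    rw [h2] at h1
    linarith
  intro x hx
  by_contra! hneg
  have hp : 0 < a ‖x‖ + 1 := by linarith [hann x hx]
  -- An explicit `ε` in place of a limit: it makes the perturbed value `u(x) / (a + 1)`, still
  -- negative.
  have := key (-u x / (a ‖x‖ + 1)) (div_pos (neg_pos.2 hneg) hp) x hx
  have h2 : 1 * u x + -u x / (a ‖x‖ + 1) * a ‖x‖ = u x / (a ‖x‖ + 1) := by
    field_simp
    ring
  rw [h2] at this
  exact absurd (div_neg_of_neg_of_pos hneg hp) (not_lt.2 this)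

/-- Comparison with a radial solution. -/
theorem abs_le_radialGreen (hw : IsRegularWarp w S) (hR : R ∈ Ioo 0 S) {n : ℕ} {b : ℝ → ℝ}
    (hb : ContinuousOn b (Ico 0 S)) {u : EuclideanSpace ℝ (Fin (n + 1)) → ℝ}
    (hu : ContDiffOn ℝ 2 u (Metric.ball 0 R)) (huc : ContinuousOn u (Metric.closedBall 0 R))
    (hΔ : ∀ x ∈ Metric.ball 0 R, |laplaceBeltrami (modelMetric (n + 1) w) u x| ≤ b ‖x‖)
    (h0 : ∀ x ∈ Metric.sphere 0 R, u x = 0) {x : EuclideanSpace ℝ (Fin (n + 1))}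
    (hx : x ∈ Metric.closedBall 0 R) : |u x| ≤ radialGreen n w R b ‖x‖ := by
  have hRS := Ioo_subset_Ico_self hR
  have key : ∀ σ : ℝ, |σ| = 1 → 0 ≤ 1 * radialGreen n w R b ‖x‖ + σ * u x := by
    intro σ hσ
    have hgc : ContDiffOn ℝ 2 (fun y : EuclideanSpace ℝ (Fin (n + 1)) => radialGreen n w R b ‖y‖)
      (Metric.ball 0 R) :=
      fun y hy => (hw.contDiffAt_radialGreen_norm hR n hb hy).contDiffWithinAt
    refine hw.nonneg_of_laplaceBeltrami_add_nonpos hR le_rfl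
      (u := fun x => 1 * radialGreen n w R b ‖x‖ + σ * u x)
      ((contDiffOn_const.mul hgc).add (contDiffOn_const.mul hu))
      ((continuousOn_const.mul (continuousOn_comp_norm hR
        (hw.continuousOn_radialGreen n hb hRS))).add (continuousOn_const.mul huc))
      (fun y hy => ?_) (fun y hy => ?_) x hx
    · rw [laplaceBeltrami_lincomb (hw.differentiableAt_coeff_of_mem_ball hR n hy)
        (hw.contDiffAt_radialGreen_norm hR n hb hy)
        (hu.contDiffAt (Metric.isOpen_ball.mem_nhds hy)),
        hw.laplaceBeltrami_radialGreen n hb hRS ((mem_ball_zero_iff.1 hy).trans hR.2)]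
      have h1 := (le_abs_self (σ * laplaceBeltrami (modelMetric (n + 1) w) u y)).trans_eq
        (abs_mul _ _)
      rw [hσ, one_mul] at h1
      linarith [hΔ y hy]
    · rw [h0 y hy, mem_sphere_zero_iff_norm.1 hy, radialGreen_self]
      simp
  have h1 := key 1 (by simp)
  have h2 := key (-1) (by simp)
  rw [abs_le]
  constructor <;> linarith

/-- Comparison applied to the difference of the two solutions. The source `0 * b` is chosen so that
homogeneity of `radialGreen` makes the bound zero. -/
theorem eq_radialGreen (hw : IsRegularWarp w S) (hR : R ∈ Ioo 0 S) {n : ℕ} {b : ℝ → ℝ}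
    (hb : ContinuousOn b (Ico 0 S)) {u : EuclideanSpace ℝ (Fin (n + 1)) → ℝ}
    (hu : ContDiffOn ℝ 2 u (Metric.ball 0 R)) (huc : ContinuousOn u (Metric.closedBall 0 R))
    (hΔ : ∀ x ∈ Metric.ball 0 R, laplaceBeltrami (modelMetric (n + 1) w) u x = -b ‖x‖)
    (h0 : ∀ x ∈ Metric.sphere 0 R, u x = 0) {x : EuclideanSpace ℝ (Fin (n + 1))}
    (hx : x ∈ Metric.closedBall 0 R) : u x = radialGreen n w R b ‖x‖ := by
  have hRS := Ioo_subset_Ico_self hR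
  have hgc : ContDiffOn ℝ 2 (fun y : EuclideanSpace ℝ (Fin (n + 1)) => radialGreen n w R b ‖y‖)
    (Metric.ball 0 R) :=
    fun y hy => (hw.contDiffAt_radialGreen_norm hR n hb hy).contDiffWithinAt
  have h := hw.abs_le_radialGreen hR (b := fun s => 0 * b s) (continuousOn_const.mul hb)
    (u := fun y => 1 * u y + (-1) * radialGreen n w R b ‖y‖)
    ((contDiffOn_const.mul hu).add (contDiffOn_const.mul hgc))
    ((continuousOn_const.mul huc).add (continuousOn_const.mul (continuousOn_comp_norm hR
        (hw.continuousOn_radialGreen n hb hRS)))) (fun y hy => ?_) (fun y hy => ?_) hx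
  · rw [radialGreen_const_mul, zero_mul] at h
    linarith [abs_nonpos_iff.1 h]
  · rw [laplaceBeltrami_lincomb (hw.differentiableAt_coeff_of_mem_ball hR n hy)
      (hu.contDiffAt (Metric.isOpen_ball.mem_nhds hy))
      (hw.contDiffAt_radialGreen_norm hR n hb hy), hΔ y hy,
      hw.laplaceBeltrami_radialGreen n hb hRS ((mem_ball_zero_iff.1 hy).trans hR.2)]
    simp
  · rw [h0 y hy, mem_sphere_zero_iff_norm.1 hy, radialGreen_self]
    simp

/-! ### Exit time moment functions -/

theorem isExitMomentSequence_greenIter (hw : IsRegularWarp w S) (hR : R ∈ Ioo 0 S) (n : ℕ) :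
    IsExitMomentSequence (modelMetric (n + 1) w) (Metric.ball 0 R)
      fun k x => (k.factorial : ℝ) * greenIter n w R k ‖x‖ := by
  have hRS := Ioo_subset_Ico_self hR
  have hb : ∀ k : ℕ, ContinuousOn (fun s => ((k + 1).factorial : ℝ) * greenIter n w R k s)
    (Ico 0 S) := fun k => continuousOn_const.mul (hw.continuousOn_greenIter hR n k)
  have hG : ∀ k : ℕ, (fun x : EuclideanSpace ℝ (Fin (n + 1)) =>
      ((k + 1).factorial : ℝ) * greenIter n w R (k + 1) ‖x‖) = fun x =>
      radialGreen n w R (fun s => ((k + 1).factorial : ℝ) * greenIter n w R k s) ‖x‖ := fun k => by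
    ext x
    rw [radialGreen_const_mul, greenIter]
  refine ⟨fun x _ => by simp [greenIter], fun k => ?_, fun k => ?_, fun k x hx => ?_,
    fun k x hx => ?_⟩
  · rw [hG]
    exact fun y hy => (hw.contDiffAt_radialGreen_norm hR n (hb k) hy).contDiffWithinAt
  · rw [hG, closure_ball _ hR.1.ne']
    exact continuousOn_comp_norm hR (hw.continuousOn_radialGreen n (hb k) hRS)
  · rw [hG, hw.laplaceBeltrami_radialGreen n (hb k) hRS ((mem_ball_zero_iff.1 hx).trans hR.2),
      Nat.factorial_succ]
    push_cast
    ring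
  · rw [frontier_ball _ hR.1.ne'] at hx
    rw [mem_sphere_zero_iff_norm.1 hx, greenIter, radialGreen_self, mul_zero]

/-- Induction on `k` by uniqueness of the Dirichlet problem. The formula starts at `k + 1` because
`u 0` is prescribed on the open ball only, which is all that the equation for `u 1` needs. -/
theorem exitMoment_succ_eq (hw : IsRegularWarp w S) (hR : R ∈ Ioo 0 S) {n : ℕ}
    {u : ℕ → EuclideanSpace ℝ (Fin (n + 1)) → ℝ}
    (hu : IsExitMomentSequence (modelMetric (n + 1) w) (Metric.ball 0 R) u) (k : ℕ) :
    ∀ x ∈ Metric.closedBall 0 R,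
      u (k + 1) x = ((k + 1).factorial : ℝ) * greenIter n w R (k + 1) ‖x‖ := by
  have step : ∀ k : ℕ, (∀ x ∈ Metric.ball 0 R, u k x = (k.factorial : ℝ) * greenIter n w R k ‖x‖) →
      ∀ x ∈ Metric.closedBall 0 R,
        u (k + 1) x = ((k + 1).factorial : ℝ) * greenIter n w R (k + 1) ‖x‖ := by
    intro k hk x hx
    have hc := hu.continuousOn k
    have hb := hu.boundary k
    rw [closure_ball _ hR.1.ne'] at hc
    rw [frontier_ball _ hR.1.ne'] at hb
    have h := hw.eq_radialGreen hR (b := fun s => ((k + 1).factorial : ℝ) * greenIter n w R k s)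
      (continuousOn_const.mul (hw.continuousOn_greenIter hR n k)) (hu.contDiffOn k) hc
      (fun y hy => ?_) hb hx
    · rw [h, radialGreen_const_mul, greenIter]
    · have := hu.equation k y hy
      rw [hk y hy] at this
      rw [Nat.factorial_succ]
      push_cast
      linarith
  induction k with
  | zero => exact step 0 fun x hx => by rw [hu.zero_eq_one x hx]; simp [greenIter]
  | succ k ih => exact step (k + 1) fun x hx => ih x (Metric.ball_subset_closedBall hx)

theorem exitMoment_eq (hw : IsRegularWarp w S) (hR : R ∈ Ioo 0 S) {n : ℕ}
    {u : ℕ → EuclideanSpace ℝ (Fin (n + 1)) → ℝ}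
    (hu : IsExitMomentSequence (modelMetric (n + 1) w) (Metric.ball 0 R) u) (k : ℕ) :
    ∀ x ∈ Metric.ball 0 R, u k x = (k.factorial : ℝ) * greenIter n w R k ‖x‖ := by
  intro x hx
  cases k with
  | zero => rw [hu.zero_eq_one x hx]; simp [greenIter]
  | succ k => exact hw.exitMoment_succ_eq hR hu k x (Metric.ball_subset_closedBall hx)

/-! ### The first eigenvalue -/

/-- The fixed point equation is also a regularity statement: `G = T(μ⁻¹ G)` on `[0, R]` makes a
merely continuous `G` a `C²` radial function with zero boundary values. -/
theorem isDirichletEigenfunction_of_radialGreen_eq (hw : IsRegularWarp w S) (hR : R ∈ Ioo 0 S)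
    {n : ℕ} {μ : ℝ} (hμ : 0 < μ) {G : ℝ → ℝ} (hG : Continuous G) (hG0 : G 0 = 1)
    (hfix : ∀ r ∈ Icc 0 R, radialGreen n w R G r = μ * G r)
    {u : EuclideanSpace ℝ (Fin (n + 1)) → ℝ} (hu : ∀ x ∈ Metric.closedBall 0 R, u x = G ‖x‖) :
    IsDirichletEigenfunction (modelMetric (n + 1) w) (Metric.ball 0 R) μ⁻¹ u := by
  have hRS := Ioo_subset_Ico_self hR
  have hb : ContinuousOn (fun s => μ⁻¹ * G s) (Ico 0 S) := (continuous_const.mul hG).continuousOn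
  have hrep : ∀ x ∈ Metric.closedBall (0 : EuclideanSpace ℝ (Fin (n + 1))) R,
      u x = radialGreen n w R (fun s => μ⁻¹ * G s) ‖x‖ := fun x hx => by
    rw [radialGreen_const_mul, hfix _ (norm_mem_Icc hx), inv_mul_cancel_left₀ hμ.ne', hu x hx]
  have h0 : (0 : EuclideanSpace ℝ (Fin (n + 1))) ∈ Metric.ball 0 R := Metric.mem_ball_self hR.1
  refine ⟨?_, ?_, ⟨0, h0, ?_⟩, fun x hx => ?_, fun x hx => ?_⟩
  · exact ContDiffOn.congr
      (fun y hy => (hw.contDiffAt_radialGreen_norm hR n hb hy).contDiffWithinAt)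
      fun x hx => hrep x (Metric.ball_subset_closedBall hx)
  · rw [closure_ball _ hR.1.ne']
    exact (continuousOn_comp_norm hR (hw.continuousOn_radialGreen n hb hRS)).congr hrep
  · rw [hu 0 (Metric.ball_subset_closedBall h0), norm_zero, hG0]
    exact one_ne_zero
  · have hev : u =ᶠ[𝓝 x] fun y => radialGreen n w R (fun s => μ⁻¹ * G s) ‖y‖ := by
      filter_upwards [Metric.isOpen_ball.mem_nhds hx] with y hy
      exact hrep y (Metric.ball_subset_closedBall hy)
    rw [laplaceBeltrami_congr _ hev,
      hw.laplaceBeltrami_radialGreen n hb hRS ((mem_ball_zero_iff.1 hx).trans hR.2),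
      hu x (Metric.ball_subset_closedBall hx)]
    ring
  · rw [frontier_ball _ hR.1.ne'] at hx
    rw [hrep x (Metric.sphere_subset_closedBall hx), mem_sphere_zero_iff_norm.1 hx,
      radialGreen_self]

/-- Since `|Δv| = |lam| |v|`, comparison turns a bound by `C |lam|ᵏ a_k` into one with an additional
factor `|lam|` and an additional `T`. -/
theorem eigenfunction_le (hw : IsRegularWarp w S) (hR : R ∈ Ioo 0 S) {n : ℕ} {lam : ℝ}
    {v : EuclideanSpace ℝ (Fin (n + 1)) → ℝ}
    (hv : IsDirichletEigenfunction (modelMetric (n + 1) w) (Metric.ball 0 R) lam v) {C : ℝ}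
    (hC : ∀ x ∈ Metric.closedBall 0 R, |v x| ≤ C) (k : ℕ) :
    ∀ x ∈ Metric.closedBall 0 R, |v x| ≤ C * |lam| ^ k * greenIter n w R k ‖x‖ := by
  have hc := hv.continuousOn
  have hb := hv.boundary
  rw [closure_ball _ hR.1.ne'] at hc
  rw [frontier_ball _ hR.1.ne'] at hb
  induction k with
  | zero => simpa [greenIter] using hC
  | succ k ih =>
    intro x hx
    have h := hw.abs_le_radialGreen hR (b := fun s => C * |lam| ^ (k + 1) * greenIter n w R k s)
      (continuousOn_const.mul (hw.continuousOn_greenIter hR n k)) hv.contDiffOn hc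
      (fun y hy => ?_) hb hx
    · rwa [radialGreen_const_mul] at h
    · have h1 : laplaceBeltrami (modelMetric (n + 1) w) v y = -(lam * v y) := by
        linarith [hv.equation y hy]
      rw [h1, abs_neg, abs_mul]
      refine (mul_le_mul_of_nonneg_left (ih y (Metric.ball_subset_closedBall hy))
        (abs_nonneg lam)).trans_eq ?_
      ring

/-- For `lam < 0` the maximum principle for `Δ + lam` applies to both `v` and `-v`. -/
theorem eigenvalue_nonneg (hw : IsRegularWarp w S) (hR : R ∈ Ioo 0 S) {n : ℕ} {lam : ℝ}
    {v : EuclideanSpace ℝ (Fin (n + 1)) → ℝ}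
    (hv : IsDirichletEigenfunction (modelMetric (n + 1) w) (Metric.ball 0 R) lam v) :
    0 ≤ lam := by
  by_contra! hneg
  have hc := hv.continuousOn
  have hb := hv.boundary
  rw [closure_ball _ hR.1.ne'] at hc
  rw [frontier_ball _ hR.1.ne'] at hb
  obtain ⟨x, hx, hne⟩ := hv.ne_zero
  have key : ∀ σ : ℝ, 0 ≤ σ * v x + 0 * v x := fun σ =>
    hw.nonneg_of_laplaceBeltrami_add_nonpos hR hneg.le (u := fun y => σ * v y + 0 * v y)
      ((contDiffOn_const.mul hv.contDiffOn).add (contDiffOn_const.mul hv.contDiffOn))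
      ((continuousOn_const.mul hc).add (continuousOn_const.mul hc))
      (fun y hy => by
        have hcd := hv.contDiffOn.contDiffAt (Metric.isOpen_ball.mem_nhds hy)
        rw [laplaceBeltrami_lincomb (hw.differentiableAt_coeff_of_mem_ball hR n hy) hcd hcd]
        have := congrArg (σ * ·) (hv.equation y hy)
        simp only [mul_zero] at this
        linarith)
      (fun y hy => by rw [hb y hy]; simp) x (Metric.ball_subset_closedBall hx)
  have h1 := key 1
  have h2 := key (-1)
  exact hne (by linarith)

/-- If `0 < lam < 1/μ`, the terms `lamᵏ a_k(0)` have consecutive quotients tending to `lam μ < 1`,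
so the bounds of `eigenfunction_le` tend to zero. -/
theorem inv_le_eigenvalue (hw : IsRegularWarp w S) (hR : R ∈ Ioo 0 S) {n : ℕ} {μ : ℝ}
    (hμ : 0 < μ) (hlim : Tendsto (greenRatio n w R) atTop (𝓝 μ)) {lam : ℝ}
    {v : EuclideanSpace ℝ (Fin (n + 1)) → ℝ}
    (hv : IsDirichletEigenfunction (modelMetric (n + 1) w) (Metric.ball 0 R) lam v) :
    μ⁻¹ ≤ lam := by
  by_contra! hlt
  have hnn := hw.eigenvalue_nonneg hR hv
  obtain ⟨x, hx, hne⟩ := hv.ne_zero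
  have hx' := Metric.ball_subset_closedBall hx
  have hc := hv.continuousOn
  rw [closure_ball _ hR.1.ne'] at hc
  obtain ⟨C, hC⟩ := (isCompact_closedBall (0 : EuclideanSpace ℝ (Fin (n + 1)))
    R).exists_bound_of_continuousOn hc
  have hle := fun k => hw.eigenfunction_le hR hv hC k x hx'
  -- The ratio test needs nonzero terms, so `lam = 0` is treated apart; there the bound for `k = 1`
  -- is already zero.
  rcases hnn.eq_or_lt with h0 | h0
  · have := hle 1
    rw [← h0] at this
    simp only [abs_zero, pow_one, mul_zero, zero_mul] at this
    exact hne (abs_nonpos_iff.1 this)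
  · have hsum : Summable fun k => lam ^ k * greenIter n w R k 0 := by
      refine summable_of_ratio_test_tendsto_lt_one (l := lam * μ) ?_
        (Eventually.of_forall fun k =>
          (mul_pos (_root_.pow_pos h0 k) (hw.greenIter_zero_pos hR n k)).ne') ?_
      · rwa [← lt_div_iff₀ hμ, one_div]
      · refine (hlim.const_mul lam).congr fun k => ?_
        have h1 := hw.greenIter_zero_pos hR n k
        have h2 := hw.greenIter_zero_pos hR n (k + 1)
        rw [Real.norm_of_nonneg (mul_pos (_root_.pow_pos h0 _) h2).le,
          Real.norm_of_nonneg (mul_pos (_root_.pow_pos h0 _) h1).le, greenRatio, pow_succ]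
        field_simp
    have hz := hsum.tendsto_atTop_zero.const_mul C
    rw [mul_zero] at hz
    have hC0 : 0 ≤ C := (norm_nonneg _).trans (hC x hx')
    refine hne (abs_nonpos_iff.1 (ge_of_tendsto' hz fun k => (hle k).trans ?_))
    rw [abs_of_pos h0, ← mul_assoc]
    exact mul_le_mul_of_nonneg_left
      (hw.greenIter_antitone hR n k le_rfl (norm_nonneg x) (norm_mem_Icc hx').2)
      (mul_nonneg hC0 (_root_.pow_nonneg h0.le k))

end IsRegularWarp

/-! ### The `L¹`-moments -/

theorem setIntegral_ball_pos {n : ℕ} {R : ℝ} (hR : 0 < R)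
    {f : EuclideanSpace ℝ (Fin n) → ℝ} (hf : ContinuousOn f (Metric.closedBall 0 R))
    (hnn : ∀ x ∈ Metric.ball 0 R, 0 ≤ f x) (h0 : 0 < f 0) :
    0 < ∫ x in Metric.ball 0 R, f x := by
  have hint : IntegrableOn f (Metric.ball 0 R) :=
    (hf.integrableOn_compact (isCompact_closedBall _ _)).mono_set Metric.ball_subset_closedBall
  rw [setIntegral_pos_iff_support_of_nonneg_ae
    ((ae_restrict_iff' measurableSet_ball).2 (Eventually.of_forall hnn)) hint]
  refine Measure.measure_pos_of_mem_nhds volume (x := 0) (inter_mem ?_ (Metric.ball_mem_nhds 0 hR))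
  have hc : ContinuousAt f 0 := hf.continuousAt (Metric.closedBall_mem_nhds 0 hR)
  filter_upwards [hc.eventually (lt_mem_nhds h0)] with x hx
  exact hx.ne'

/-- The integral of a radial function over a geodesic ball. -/
def radialIntegral (n : ℕ) (w : ℝ → ℝ) (R : ℝ) (f : ℝ → ℝ) : ℝ :=
  ∫ x in Metric.ball (0 : EuclideanSpace ℝ (Fin (n + 1))) R, f ‖x‖ * warpRatio w ‖x‖ ^ n

theorem radialIntegral_const_mul (n : ℕ) (w : ℝ → ℝ) (R c : ℝ) (f : ℝ → ℝ) :
    radialIntegral n w R (fun r => c * f r) = c * radialIntegral n w R f := by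
  simp only [radialIntegral, mul_assoc, integral_const_mul]

namespace IsRegularWarp

variable {w : ℝ → ℝ} {S R : ℝ}

theorem volumeIntegral_eq_radialIntegral (hw : IsRegularWarp w S) (hR : R ∈ Ioo 0 S) {n : ℕ}
    {u : EuclideanSpace ℝ (Fin (n + 1)) → ℝ} {f : ℝ → ℝ}
    (hu : ∀ x ∈ Metric.ball 0 R, u x = f ‖x‖) :
    volumeIntegral (modelMetric (n + 1) w) (Metric.ball 0 R) u = radialIntegral n w R f := by
  refine setIntegral_congr_fun measurableSet_ball fun x hx => ?_
  have hx' : ‖x‖ ∈ Ico 0 S := ⟨norm_nonneg x, (mem_ball_zero_iff.1 hx).trans hR.2⟩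
  simp only [hu x hx, volumeDensity_modelMetric (by omega : 1 ≤ n + 1) w (hw.warpRatio_pos hx'),
    Nat.add_sub_cancel]

theorem continuousOn_mul_warpRatio_pow (hw : IsRegularWarp w S) (hR : R ∈ Ioo 0 S) (n : ℕ)
    {f : ℝ → ℝ} (hf : ContinuousOn f (Ico 0 S)) {E : Type*} [NormedAddCommGroup E] :
    ContinuousOn (fun x : E => f ‖x‖ * warpRatio w ‖x‖ ^ n) (Metric.closedBall 0 R) :=
  (continuousOn_comp_norm hR hf).mul ((continuousOn_comp_norm hR hw.continuousOn_warpRatio).pow n)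

theorem radialIntegral_pos (hw : IsRegularWarp w S) (hR : R ∈ Ioo 0 S) (n : ℕ)
    {f : ℝ → ℝ} (hf : ContinuousOn f (Ico 0 S)) (hnn : ∀ r ∈ Icc 0 R, 0 ≤ f r) (h0 : 0 < f 0) :
    0 < radialIntegral n w R f := by
  refine setIntegral_ball_pos hR.1 (hw.continuousOn_mul_warpRatio_pow hR n hf) (fun x hx => ?_) ?_
  · have hx' := norm_mem_Icc (Metric.ball_subset_closedBall hx)
    exact mul_nonneg (hnn _ hx')
      (_root_.pow_nonneg (hw.warpRatio_pos (mem_Ico_of_mem_Icc hR hx')).le n)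
  · simpa [warpRatio_zero] using h0

theorem tendsto_radialIntegral (hw : IsRegularWarp w S) (hR : R ∈ Ioo 0 S) (n : ℕ)
    {f : ℕ → ℝ → ℝ} {F : ℝ → ℝ} (hf : ∀ k, ContinuousOn (f k) (Ico 0 S))
    (hle : ∀ k, ∀ r ∈ Icc 0 R, |f k r| ≤ 1)
    (hlim : ∀ r ∈ Icc 0 R, Tendsto (fun k => f k r) atTop (𝓝 (F r))) :
    Tendsto (fun k => radialIntegral n w R (f k)) atTop (𝓝 (radialIntegral n w R F)) := by
  have hint : ∀ {f : ℝ → ℝ}, ContinuousOn f (Ico 0 S) →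
      IntegrableOn (fun x : EuclideanSpace ℝ (Fin (n + 1)) => f ‖x‖ * warpRatio w ‖x‖ ^ n)
        (Metric.ball 0 R) := fun hf =>
    ((hw.continuousOn_mul_warpRatio_pow hR n hf).integrableOn_compact
      (isCompact_closedBall _ _)).mono_set Metric.ball_subset_closedBall
  refine tendsto_integral_of_dominated_convergence
    (fun x : EuclideanSpace ℝ (Fin (n + 1)) => (1 : ℝ) * warpRatio w ‖x‖ ^ n)
    (fun k => (hint (hf k)).aestronglyMeasurable) (hint continuousOn_const) (fun k => ?_) ?_
  all_goals
    refine (ae_restrict_iff' measurableSet_ball).2 (Eventually.of_forall fun x hx => ?_)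
    have hx' := norm_mem_Icc (Metric.ball_subset_closedBall hx)
  · have h1 := _root_.pow_nonneg (hw.warpRatio_pos (mem_Ico_of_mem_Icc hR hx')).le n
    rw [norm_mul, Real.norm_of_nonneg h1]
    exact mul_le_mul_of_nonneg_right (hle k _ hx') h1
  · exact (hlim _ hx').mul_const _

theorem greenIter_eq_mul (hw : IsRegularWarp w S) (hR : R ∈ Ioo 0 S) (n k : ℕ) (r : ℝ) :
    greenIter n w R k r = greenIter n w R k 0 * greenNormalized n w R k r :=
  (mul_div_cancel₀ _ (hw.greenIter_zero_pos hR n k).ne').symm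

theorem volumeIntegral_exitMoment (hw : IsRegularWarp w S) (hR : R ∈ Ioo 0 S) {n : ℕ}
    {u : ℕ → EuclideanSpace ℝ (Fin (n + 1)) → ℝ}
    (hu : IsExitMomentSequence (modelMetric (n + 1) w) (Metric.ball 0 R) u) (k : ℕ) :
    volumeIntegral (modelMetric (n + 1) w) (Metric.ball 0 R) (u k) =
      (k.factorial * greenIter n w R k 0) * radialIntegral n w R (greenNormalized n w R k) := by
  rw [← radialIntegral_const_mul]
  refine hw.volumeIntegral_eq_radialIntegral hR fun x hx => ?_
  rw [hw.exitMoment_eq hR hu k x hx, mul_assoc, ← hw.greenIter_eq_mul hR]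

theorem radialIntegral_greenNormalized_pos (hw : IsRegularWarp w S) (hR : R ∈ Ioo 0 S)
    (n k : ℕ) : 0 < radialIntegral n w R (greenNormalized n w R k) :=
  hw.radialIntegral_pos hR n (hw.continuousOn_greenNormalized hR n k)
    (fun _ hr => hw.greenNormalized_nonneg hR n k hr)
    (by rw [hw.greenNormalized_zero hR]; exact one_pos)

/-- By dominated convergence numerator and denominator have the same limit `∫ G dV`, which is
positive because `G(0) = 1`. -/
theorem tendsto_radialIntegral_div (hw : IsRegularWarp w S) (hR : R ∈ Ioo 0 S) {n : ℕ}
    {G : ℝ → ℝ} (hG : Continuous G) (hG0 : G 0 = 1)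
    (hlim : ∀ r ∈ Icc 0 R, Tendsto (fun k => greenNormalized n w R k r) atTop (𝓝 (G r))) :
    Tendsto (fun k => radialIntegral n w R (greenNormalized n w R k) /
      radialIntegral n w R (greenNormalized n w R (k + 1))) atTop (𝓝 1) := by
  have hnn := fun k r (hr : r ∈ Icc 0 R) => hw.greenNormalized_nonneg hR n k hr
  have h := hw.tendsto_radialIntegral hR n (hw.continuousOn_greenNormalized hR n)
    (fun k r hr => by
      rw [abs_of_nonneg (hnn k r hr)]; exact hw.greenNormalized_le_one hR n k hr) hlim
  have hpos : 0 < radialIntegral n w R G := hw.radialIntegral_pos hR n hG.continuousOn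
    (fun r hr => ge_of_tendsto' (hlim r hr) fun k => hnn k r hr) (by rw [hG0]; exact one_pos)
  have h2 := h.div (h.comp (tendsto_add_atTop_nat 1)) hpos.ne'
  rw [div_self hpos.ne'] at h2
  exact h2

end IsRegularWarp

end ModelSpace

end

/-! ### Assembly of the main theorem -/

open Filter Topology Set ModelSpace in
theorem theoremA (m : ℕ) (hm : 1 ≤ m) (L : EReal) (w : ℝ → ℝ)
    (hw : ModelSpace.IsWarpingFunction L w) (R : ℝ) (hR : 0 < R) (hRL : (R : EReal) < L) :
    -- the first Dirichlet eigenvalue exists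
    IsLeast
      (ModelSpace.dirichletEigenvalues (ModelSpace.modelMetric m w) (ModelSpace.modelBall m L w R))
      (ModelSpace.lambda1 (ModelSpace.modelMetric m w) (ModelSpace.modelBall m L w R)) ∧
    -- the exit time moment functions exist
    (∃ u : ℕ → EuclideanSpace ℝ (Fin m) → ℝ,
      ModelSpace.IsExitMomentSequence (ModelSpace.modelMetric m w)
        (ModelSpace.modelBall m L w R) u) ∧
    ∀ u : ℕ → EuclideanSpace ℝ (Fin m) → ℝ,
      ModelSpace.IsExitMomentSequence (ModelSpace.modelMetric m w)
        (ModelSpace.modelBall m L w R) u →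
      -- the quotients below have non-zero denominators
      (∀ k : ℕ, 0 < u k 0) ∧
      (∀ k : ℕ, 0 < ModelSpace.volumeIntegral (ModelSpace.modelMetric m w)
        (ModelSpace.modelBall m L w R) (u k)) ∧
      Filter.Tendsto (fun k : ℕ => ((k : ℝ) + 1) * u k 0 / u (k + 1) 0) Filter.atTop
        (nhds (ModelSpace.lambda1 (ModelSpace.modelMetric m w)
          (ModelSpace.modelBall m L w R))) ∧
      Filter.Tendsto
        (fun k : ℕ => ((k : ℝ) + 1) *
          ModelSpace.volumeIntegral (ModelSpace.modelMetric m w)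
            (ModelSpace.modelBall m L w R) (u k) /
          ModelSpace.volumeIntegral (ModelSpace.modelMetric m w)
            (ModelSpace.modelBall m L w R) (u (k + 1)))
        Filter.atTop
        (nhds (ModelSpace.lambda1 (ModelSpace.modelMetric m w)
          (ModelSpace.modelBall m L w R))) ∧
      -- the limit `g_∞` is a radial `C²` eigenfunction for the first eigenvalue
      ∃ G : ℝ → ℝ, ContDiffOn ℝ 2 G (Set.Icc 0 R) ∧
        (∀ x ∈ closure (ModelSpace.modelBall m L w R),
          Filter.Tendsto (fun k : ℕ => u k x / u k 0) Filter.atTop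
            (nhds (G (ModelSpace.poleDist m L w x).toReal))) ∧
        ModelSpace.IsDirichletEigenfunction (ModelSpace.modelMetric m w)
          (ModelSpace.modelBall m L w R)
          (ModelSpace.lambda1 (ModelSpace.modelMetric m w) (ModelSpace.modelBall m L w R))
          (fun x => G (ModelSpace.poleDist m L w x).toReal) := by
  obtain ⟨n, rfl⟩ : ∃ n, m = n + 1 := ⟨m - 1, by omega⟩
  -- A finite radius between `R` and `L` gives regularity on a neighbourhood of the closed ball,
  -- also when `L = ∞`.
  obtain ⟨S, hRS, hSL⟩ := EReal.lt_iff_exists_real_btwn.1 hRL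
  rw [EReal.coe_lt_coe_iff] at hRS
  have hreg := hw.isRegularWarp (hR.trans hRS) hSL
  have hRI : R ∈ Ioo 0 S := ⟨hR, hRS⟩
  have hdist : ∀ x ∈ Metric.closedBall (0 : EuclideanSpace ℝ (Fin (n + 1))) R,
      (poleDist (n + 1) L w x).toReal = ‖x‖ := fun x hx =>
    toReal_poleDist_eq w ((EReal.coe_le_coe_iff.2 (mem_closedBall_zero_iff.1 hx)).trans_lt hRL)
  rw [modelBall_eq_ball w hRL]
  obtain ⟨μ, hμ, G, hG, hratio, hlim, hfix⟩ := hreg.exists_tendsto_greenNormalized hRI n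
  have hG0 : G 0 = 1 := tendsto_nhds_unique (hlim 0 (left_mem_Icc.2 hR.le)) (by
    simp only [hreg.greenNormalized_zero hRI]
    exact tendsto_const_nhds)
  have heig : IsDirichletEigenfunction (modelMetric (n + 1) w) (Metric.ball 0 R) μ⁻¹
      fun x => G (poleDist (n + 1) L w x).toReal :=
    hreg.isDirichletEigenfunction_of_radialGreen_eq hRI hμ hG hG0 hfix fun x hx => by
      rw [hdist x hx]
  have hleast : IsLeast (dirichletEigenvalues (modelMetric (n + 1) w) (Metric.ball 0 R)) μ⁻¹ :=
    ⟨⟨_, heig⟩, fun lam ⟨v, hv⟩ => hreg.inv_le_eigenvalue hRI hμ hratio hv⟩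
  have hlam : lambda1 (modelMetric (n + 1) w) (Metric.ball 0 R) = μ⁻¹ := hleast.csInf_eq
  have h0 : (0 : EuclideanSpace ℝ (Fin (n + 1))) ∈ Metric.ball 0 R := Metric.mem_ball_self hR
  rw [hlam]
  refine ⟨hleast, ⟨_, hreg.isExitMomentSequence_greenIter hRI n⟩, fun u hu => ?_⟩
  have hpole : ∀ k, u k 0 = (k.factorial : ℝ) * greenIter n w R k 0 := fun k => by
    rw [hreg.exitMoment_eq hRI hu k 0 h0, norm_zero]
  have hvol := hreg.volumeIntegral_exitMoment hRI hu
  have hfac : ∀ k : ℕ, (0 : ℝ) < k.factorial := fun k => by exact_mod_cast k.factorial_pos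
  have hiter := hreg.greenIter_zero_pos hRI n
  have hrad := hreg.radialIntegral_greenNormalized_pos hRI n
  have hinv := hratio.inv₀ hμ.ne'
  refine ⟨fun k => ?_, fun k => ?_, ?_, ?_, G, ?_, fun x hx => ?_, heig⟩
  · rw [hpole]
    exact mul_pos (hfac k) (hiter k)
  · rw [hvol]
    exact mul_pos (mul_pos (hfac k) (hiter k)) (hrad k)
  · refine hinv.congr fun k => ?_
    have h1 := (hfac k).ne'
    have h2 := (hiter k).ne'
    have h3 := (hiter (k + 1)).ne'
    rw [hpole, hpole, Nat.factorial_succ, greenRatio]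
    push_cast
    field_simp
  -- The moment quotient is `1/ρ_k` times a quotient of normalized integrals that tends to `1`.
  · have h := hinv.mul (hreg.tendsto_radialIntegral_div hRI hG hG0 hlim)
    rw [mul_one] at h
    refine h.congr fun k => ?_
    have h1 := (hfac k).ne'
    have h2 := (hiter k).ne'
    have h3 := (hiter (k + 1)).ne'
    have h4 := (hrad (k + 1)).ne'
    rw [hvol, hvol, Nat.factorial_succ, greenRatio]
    push_cast
    field_simp
  -- On `[0, R]` the limit profile equals `T(μ⁻¹ G)`, which supplies its two derivatives up to both
  -- ends.
  · refine (hreg.contDiffOn_radialGreen n (b := fun s => μ⁻¹ * G s)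
      (continuous_const.mul hG).continuousOn (Ioo_subset_Ico_self hRI)).congr fun r hr => ?_
    rw [radialGreen_const_mul, hfix r hr, inv_mul_cancel_left₀ hμ.ne']
  · rw [closure_ball _ hR.ne'] at hx
    rw [hdist x hx]
    -- The shift discards `k = 0`, where `u 0` is unknown on the boundary sphere.
    refine (tendsto_add_atTop_iff_nat 1).1 (((tendsto_add_atTop_iff_nat 1).2
      (hlim ‖x‖ (IsRegularWarp.norm_mem_Icc hx))).congr fun k => ?_)
    rw [hpole, hreg.exitMoment_succ_eq hRI hu k x hx, mul_div_mul_left _ _ (hfac (k + 1)).ne',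
      greenNormalized]
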